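/- Let $\mathbb T^n=\mathbb R^n/\mathbb Z^n$ with projection $p:\mathbb R^n\to\mathbb T^n$, and for $A\in \mathrm{SL}(n,\mathbb Z)$ write $A$ also for the induced automorphism of $\mathbb T^n$. A $C^\infty$ diffeomorphism $f$ of $\mathbb T^n$ is \emph{partially hyperbolic} if there are a $Df$-invariant continuous splitting $T\mathbb T^n=E^{ss}_f\oplus E^c_f\oplus E^{uu}_f$ into three nonzero subbundles, a Riemannian metric, and numbers $\lambda_s<1<\lambda_u$, $\lambda_s<\lambda_c^-<\lambda_c^+<\lambda_u$ such that for every $x$ and every nonzero $v\in T_x\mathbb T^n$: $\|Df_xv\|<\lambda_s\|v\|$ if $v\in E^{ss}_f(x)$; $\lambda_c^-\|v\|<\|Df_xv\|<\lambda_c^+\|v\|$ if $v\in E^{c}_f(x)$; and $\lambda_u\|v\|<\|Df_xv\|$ if $v\in E^{uu}_f(x)$. If $A$ is partially hyperbolic with a linear splitting $\mathbb R^n=E^{ss}_A\oplus E^c_A\oplus E^{uu}_A$, let $\mathcal{PH}_A(\mathbb T^n)$ be the set of partially hyperbolic diffeomorphisms $f$ of $\mathbb T^n$ that are (smoothly)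 isotopic to $A$ and satisfy $\dim E^*_f=\dim E^*_A$ for $*=ss,c,uu$. A bijection $f$ of $\mathbb T^n$ is \emph{expansive} if there is $\delta>0$ such that $d(f^k(x),f^k(y))\le\delta$ for all $k\in\mathbb Z$ implies $x=y$. (1) Let $A\in\mathrm{SL}(n,\mathbb Z)$ be symmetric and partially hyperbolic with a linear splitting $\mathbb R^n=E^{ss}_A\oplus E^c_A\oplus E^{uu}_A$, where $\dim E^c_A=k$ and $E^c_A$ has a basis of eigenvectors of $A$ with eigenvalues $0<\lambda_1\le\dots\le\lambda_k<1$. Then for every $\varepsilon>0$ there is $f\in\mathcal{PH}_A(\mathbb T^n)$ such that $f(x)=Ax$ for every $x\notin p(B(0,\varepsilon))$, $f$ is expansive, $f(0)=0$ and $Df_0|_{E^c_f(0)}=\mathrm{Id}$. (2) Let $A\in\mathrm{SL}(4,\mathbb Z)$ have four eigenvalues $0<\lambda^{ss}<\lambda<1<\mu<\mu^{uu}$, and let $E^{ss}_A$, $E^c_A$, $E^{uu}_A$ be, respectively, the eigenspace of $\lambda^{ss}$, the sum of the eigenspaces of $\lambda$ and $\mu$, and the eigenspace of $\mu^{uu}$.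 Then for every $\varepsilon>0$ there is $f\in\mathcal{PH}_A(\mathbb T^4)$, with $\dim E^c_f=2$, such that $f(x)=Ax$ for every $x\notin p(B(0,\varepsilon))$, $f$ is expansive, $f(0)=0$ and $Df_0|_{E^c_f(0)}=\mathrm{Id}$. -/

import Mathlib

open scoped ContDiff

namespace ToralPH

noncomputable section

/-- The Euclidean space `ℝⁿ`. -/
abbrev E (n : ℕ) := EuclideanSpace ℝ (Fin n)

/-- The torus `𝕋ⁿ = ℝⁿ / ℤⁿ`, as a product of `n` circles `ℝ / ℤ`. -/
abbrev Torus (n : ℕ) := UnitAddTorus (Fin n)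

/-- The canonical projection `ℝⁿ → 𝕋ⁿ`. -/
def proj {n : ℕ} (x : E n) : Torus n := fun i => ((x i : ℝ) : UnitAddCircle)

theorem proj_surjective {n : ℕ} : Function.Surjective (proj (n := n)) := by
  intro y
  choose x hx using fun i => QuotientAddGroup.mk_surjective (y i)
  exact ⟨WithLp.toLp 2 x, funext fun i => hx i⟩

/-! ### Smooth maps of the torus and their derivatives

The tangent bundle of `𝕋ⁿ` is `𝕋ⁿ × ℝⁿ`; a self-map of `𝕋ⁿ` is smooth exactly when it has a smooth
lift to `ℝⁿ`, and its derivative is the derivative of any such lift. -/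

/-- `F` is a `C^∞` lift of `f` to `ℝⁿ`. -/
def IsSmoothLift {n : ℕ} (F : E n → E n) (f : Torus n → Torus n) : Prop :=
  ContDiff ℝ ∞ F ∧ ∀ x, proj (F x) = f (proj x)

/-- `f : 𝕋ⁿ → 𝕋ⁿ` is `C^∞`. -/
def IsSmooth {n : ℕ} (f : Torus n → Torus n) : Prop := ∃ F, IsSmoothLift F f

open Classical in
/-- The derivative `Df_x : T_x 𝕋ⁿ = ℝⁿ → ℝⁿ = T_{f x} 𝕋ⁿ` of a smooth map `f` (see
`torusDeriv_proj` for its independence of the choice of the lift and of the point above `x`). -/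
def torusDeriv {n : ℕ} (f : Torus n → Torus n) (x : Torus n) : E n →L[ℝ] E n :=
  if h : IsSmooth f then fderiv ℝ h.choose (Function.surjInv proj_surjective x) else 0

theorem exists_const_of_proj_eq {n : ℕ} {F G : E n → E n} (hF : Continuous F) (hG : Continuous G)
    (h : ∀ x, proj (F x) = proj (G x)) : ∃ c : E n, ∀ x, F x = G x + c := by
  refine ⟨F 0 - G 0, fun x => ?_⟩
  ext i
  have hint : ∀ y, ∃ m : ℤ, F y i - G y i = (m : ℝ) := fun y => by
    have h1 := congrFun (h y) i
    simp only [proj] at h1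
    rw [eq_comm, QuotientAddGroup.eq_iff_sub_mem, ← neg_mem_iff, neg_sub,
      AddSubgroup.mem_zmultiples_iff] at h1
    obtain ⟨m, hm⟩ := h1
    exact ⟨m, by simpa using hm.symm⟩
  choose m hm using hint
  have hcont : Continuous m := by
    rw [Int.isClosedEmbedding_coe_real.isInducing.continuous_iff]
    have : ((↑) : ℤ → ℝ) ∘ m = fun y => F y i - G y i := funext fun y => (hm y).symm
    rw [this]
    fun_prop
  have := PreconnectedSpace.constant (inferInstance : PreconnectedSpace (E n)) hcont (x := x) (y := 0)
  have h1 := hm x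
  have h0 := hm 0
  rw [this, ← h0] at h1
  simp only [PiLp.add_apply, PiLp.sub_apply]
  linarith

theorem proj_add {n : ℕ} (x y : E n) : proj (x + y) = proj x + proj y := by
  funext i
  simp [proj]

theorem torusDeriv_proj {n : ℕ} {f : Torus n → Torus n} {F : E n → E n} (hF : IsSmoothLift F f)
    (x : E n) : torusDeriv f (proj x) = fderiv ℝ F x := by
  have hs : IsSmooth f := ⟨F, hF⟩
  set y := Function.surjInv proj_surjective (proj x) with hy
  have hyx : proj y = proj x := Function.surjInv_eq proj_surjective _
  have hG := hs.choose_spec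
  rw [torusDeriv, dif_pos hs]
  have hshift : ∀ z, proj (z + (y - x)) = proj z := fun z => by
    have : proj y = proj x + proj (y - x) := by rw [← proj_add]; congr 1; abel
    have h0 : proj (y - x) = 0 := by
      rw [hyx] at this
      exact left_eq_add.mp this
    rw [proj_add, h0, add_zero]
  obtain ⟨c, hc⟩ := exists_const_of_proj_eq (F := fun z => hs.choose (z + (y - x))) (G := F)
    (hG.1.continuous.comp (by fun_prop)) hF.1.continuous
    (fun z => by rw [hG.2, hF.2, hshift])
  have h1 : fderiv ℝ (fun z => hs.choose (z + (y - x))) x = fderiv ℝ F x := by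
    rw [funext hc, fderiv_add_const]
  rw [fderiv_comp_add_right] at h1
  simpa using h1

/-- `f` is a `C^∞` diffeomorphism of the torus. -/
def IsDiffeo {n : ℕ} (f : Equiv.Perm (Torus n)) : Prop := IsSmooth f ∧ IsSmooth f.symm

/-! ### Linear automorphisms -/

/-- The linear map of `ℝⁿ` given by an integer matrix. -/
def linMap {n : ℕ} (A : Matrix.SpecialLinearGroup (Fin n) ℤ) : E n →ₗ[ℝ] E n :=
  Matrix.toEuclideanLin (A.1.map (Int.cast : ℤ → ℝ))

/-- The map `f_A` of the torus induced by an integer matrix. -/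
def toralMap {n : ℕ} (M : Matrix (Fin n) (Fin n) ℤ) (x : Torus n) : Torus n :=
  fun i => ∑ j, M i j • x j

theorem toralMap_mul {n : ℕ} (M N : Matrix (Fin n) (Fin n) ℤ) (x : Torus n) :
    toralMap M (toralMap N x) = toralMap (M * N) x := by
  funext i
  simp only [toralMap, Matrix.mul_apply, Finset.sum_smul, Finset.smul_sum, mul_smul]
  exact Finset.sum_comm

theorem toralMap_one {n : ℕ} (x : Torus n) : toralMap 1 x = x := by
  funext i
  simp [toralMap, Matrix.one_apply, ite_smul]

/-- The automorphism `f_A` of the torus induced by `A ∈ SL(n, ℤ)`. -/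
def toralAut {n : ℕ} (A : Matrix.SpecialLinearGroup (Fin n) ℤ) : Equiv.Perm (Torus n) where
  toFun := toralMap A.1
  invFun := toralMap (A⁻¹).1
  left_inv x := by
    rw [toralMap_mul, ← Matrix.SpecialLinearGroup.coe_mul, inv_mul_cancel,
      Matrix.SpecialLinearGroup.coe_one, toralMap_one]
  right_inv x := by
    rw [toralMap_mul, ← Matrix.SpecialLinearGroup.coe_mul, mul_inv_cancel,
      Matrix.SpecialLinearGroup.coe_one, toralMap_one]

/-- `f_A ∘ p = p ∘ A`. -/
theorem proj_linMap {n : ℕ} (A : Matrix.SpecialLinearGroup (Fin n) ℤ) (x : E n) :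
    proj (linMap A x) = toralAut A (proj x) := by
  funext i
  change ((linMap A x i : ℝ) : UnitAddCircle) = ∑ j, A.1 i j • ((x j : ℝ) : UnitAddCircle)
  have : linMap A x i = ∑ j, A.1 i j • x j := by
    simp [linMap, Matrix.mulVec, dotProduct]
  rw [this]
  have h := map_sum (QuotientAddGroup.mk' (AddSubgroup.zmultiples (1 : ℝ)))
    (fun j => A.1 i j • x j) Finset.univ
  simp only [map_zsmul] at h
  exact h

/-! ### Partial hyperbolicity -/

/-- A smooth Riemannian metric on the torus. -/
structure RiemMetric (n : ℕ) where
  /-- The inner product on `T_x 𝕋ⁿ = ℝⁿ`. -/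
  inner : Torus n → E n →L[ℝ] E n →L[ℝ] ℝ
  symm : ∀ x v w, inner x v w = inner x w v
  pos : ∀ x v, v ≠ 0 → 0 < inner x v v
  smooth : ContDiff ℝ ∞ fun x : E n => inner (proj x)

/-- The length of the tangent vector `v ∈ T_x 𝕋ⁿ`. -/
def RiemMetric.norm {n : ℕ} (g : RiemMetric n) (x : Torus n) (v : E n) : ℝ :=
  Real.sqrt (g.inner x v v)

/-- A continuous subbundle of `T𝕋ⁿ = 𝕋ⁿ × ℝⁿ`: a field of subspaces of constant dimension whose
total space is closed (for constant dimension this is continuity into the Grassmannian). -/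
def IsSubbundle {n : ℕ} (V : Torus n → Submodule ℝ (E n)) : Prop :=
  (∃ d : ℕ, ∀ x, Module.finrank ℝ (V x) = d) ∧ IsClosed {q : Torus n × E n | q.2 ∈ V q.1}

/-- The diffeomorphism `f` of the torus is partially hyperbolic with splitting
`T𝕋ⁿ = Ess ⊕ Ec ⊕ Euu`. -/
structure IsPartiallyHyperbolic {n : ℕ} (f : Equiv.Perm (Torus n))
    (Ess Ec Euu : Torus n → Submodule ℝ (E n)) : Prop where
  diffeo : IsDiffeo f
  subbundle_ss : IsSubbundle Ess
  subbundle_c : IsSubbundle Ec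
  subbundle_uu : IsSubbundle Euu
  nontrivial : ∀ x, Ess x ≠ ⊥ ∧ Ec x ≠ ⊥ ∧ Euu x ≠ ⊥
  splitting : ∀ x, DirectSum.IsInternal ![Ess x, Ec x, Euu x]
  invariant_ss : ∀ x, (Ess x).map (torusDeriv f x : E n →ₗ[ℝ] E n) = Ess (f x)
  invariant_c : ∀ x, (Ec x).map (torusDeriv f x : E n →ₗ[ℝ] E n) = Ec (f x)
  invariant_uu : ∀ x, (Euu x).map (torusDeriv f x : E n →ₗ[ℝ] E n) = Euu (f x)
  rates : ∃ (g : RiemMetric n) (ls lc lc' lu : ℝ), ls < 1 ∧ 1 < lu ∧ ls < lc ∧ lc < lc' ∧ lc' < lu ∧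
    ∀ x v, v ≠ 0 →
      (v ∈ Ess x → g.norm (f x) (torusDeriv f x v) < ls * g.norm x v) ∧
      (v ∈ Ec x → lc * g.norm x v < g.norm (f x) (torusDeriv f x v) ∧
        g.norm (f x) (torusDeriv f x v) < lc' * g.norm x v) ∧
      (v ∈ Euu x → lu * g.norm x v < g.norm (f x) (torusDeriv f x v))

/-- `f` and `g` are smoothly isotopic: they are joined by a smooth path of diffeomorphisms. -/
def Isotopic {n : ℕ} (f g : Equiv.Perm (Torus n)) : Prop :=
  ∃ (H : ℝ → Equiv.Perm (Torus n)) (Φ : ℝ × E n → E n),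
    H 0 = f ∧ H 1 = g ∧ (∀ t ∈ Set.Icc (0 : ℝ) 1, IsDiffeo (H t)) ∧
    ContDiffOn ℝ ∞ Φ (Set.Icc (0 : ℝ) 1 ×ˢ Set.univ) ∧
    ∀ t ∈ Set.Icc (0 : ℝ) 1, ∀ x, proj (Φ (t, x)) = H t (proj x)

/-- `f ∈ PH_A(𝕋ⁿ)`, with splitting `Ess ⊕ Ec ⊕ Euu`, where `A` has the linear splitting
`ℝⁿ = Sss ⊕ Sc ⊕ Suu`: `f` is partially hyperbolic, isotopic to `f_A`, and the dimensions of the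
bundles are those of `A`. -/
structure MemPH {n : ℕ} (A : Matrix.SpecialLinearGroup (Fin n) ℤ) (Sss Sc Suu : Submodule ℝ (E n))
    (f : Equiv.Perm (Torus n)) (Ess Ec Euu : Torus n → Submodule ℝ (E n)) : Prop where
  partiallyHyperbolic : IsPartiallyHyperbolic f Ess Ec Euu
  isotopic : Isotopic f (toralAut A)
  dim_ss : ∀ x, Module.finrank ℝ (Ess x) = Module.finrank ℝ Sss
  dim_c : ∀ x, Module.finrank ℝ (Ec x) = Module.finrank ℝ Sc
  dim_uu : ∀ x, Module.finrank ℝ (Euu x) = Module.finrank ℝ Suu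

/-- Expansivity: distinct points are separated by a uniform distance at some time in `ℤ`. -/
def IsExpansive {X : Type*} [MetricSpace X] (f : Equiv.Perm X) : Prop :=
  ∃ δ > 0, ∀ x y, (∀ k : ℤ, dist ((f ^ k) x) ((f ^ k) y) ≤ δ) → x = y

end

end ToralPH

/-! In linear coordinates `A` is diagonal with entries `ν i`. Near lattice points, subtract from
the `i`-th central coordinate `(ν i - 1) ψ(‖z‖²) z i`, where the cutoff `ψ` equals `1` only at `0`.
This moves the central eigenvalues to `1` at the lattice points, through the convex combinations
`(1 - ψ) ν i + ψ`; since `ψ` can be chosen with `t ↦ |t dψ/dt|` as small as desired, the derivative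
stays within a fraction of the spectral gaps of these diagonal operators.

The linear centre directions stay invariant, so the derivative is block triangular. Because of the
gaps, a bounded shear `1 + L`, with `L` mapping the hyperbolic directions to the centre, makes it
block diagonal; `L` is the fixed point of a contraction, and the shear carries the linear splitting
to an invariant one. Shrinking the centre in the metric makes the domination hold in one step.

For expansivity, the difference `w` of two orbits which stay close forever has bounded hyperbolic
coordinates, on which the map is linear, so these vanish. On the centre, the form
`∑ i, w i ^ 2 / (ν i - 1)` increases along the pair of orbits by an amount bounded below in terms
of `‖w‖`; being bounded, it forces `w = 0`. -/

namespace ToralPH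

noncomputable section

/-! ### A slowly varying cutoff -/

/-- A smooth cutoff which equals `1` only at `0`, decreases to `0` before `ρ`, and varies slowly on
the logarithmic scale, that is, `|t dψ/dt| ≤ η`. -/
structure IsSlowCutoff (ψ : ℝ → ℝ) (η ρ : ℝ) : Prop where
  contDiff : ContDiff ℝ ∞ ψ
  apply_zero : ψ 0 = 1
  nonneg : ∀ t, 0 ≤ ψ t
  lt_one : ∀ t, t ≠ 0 → ψ t < 1
  eq_zero : ∀ t, ρ ≤ t → ψ t = 0
  antitoneOn : AntitoneOn ψ (Set.Ici 0)
  abs_mul_deriv_le : ∀ t, |t * deriv ψ t| ≤ η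

theorem deriv_smoothTransition_eq_zero {x : ℝ} (hx : x ∉ Set.Icc (0 : ℝ) 1) :
    deriv Real.smoothTransition x = 0 := by
  rw [Set.mem_Icc, not_and_or, not_le, not_le] at hx
  rcases hx with hx | hx
  · have : Real.smoothTransition =ᶠ[nhds x] fun _ => 0 := by
      filter_upwards [Iio_mem_nhds hx] with y hy
      exact Real.smoothTransition.zero_of_nonpos (Set.mem_Iio.1 hy).le
    rw [this.deriv_eq, deriv_const]
  · have : Real.smoothTransition =ᶠ[nhds x] fun _ => 1 := by
      filter_upwards [Ioi_mem_nhds hx] with y hy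
      exact Real.smoothTransition.one_of_one_le (Set.mem_Ioi.1 hy).le
    rw [this.deriv_eq, deriv_const]

theorem exists_abs_deriv_smoothTransition_le :
    ∃ K : ℝ, 0 < K ∧ ∀ x, |deriv Real.smoothTransition x| ≤ K := by
  obtain ⟨K, hK⟩ := (HasCompactSupport.intro isCompact_Icc
    fun _ hx => deriv_smoothTransition_eq_zero hx).exists_bound_of_continuous
      ((Real.smoothTransition.contDiff (n := 1)).continuous_deriv le_rfl)
  exact ⟨max K 1, by positivity, fun x => (hK x).trans (le_max_left _ _)⟩

/-- The cutoff `t ↦ S(1 - κ log(1 + c t²))`, where `S` is the smooth transition: it varies slowly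
because `log` turns the multiplicative scale into an additive one. -/
def logCutoff (κ c t : ℝ) : ℝ := Real.smoothTransition (1 - κ * Real.log (1 + c * t ^ 2))

section LogCutoff

variable {κ c : ℝ}

theorem contDiff_logCutoff (hc : 0 < c) : ContDiff ℝ ∞ (logCutoff κ c) := by
  refine Real.smoothTransition.contDiff.comp (contDiff_const.sub (contDiff_const.mul ?_))
  exact ContDiff.log (by fun_prop) fun t => by positivity

theorem logCutoff_lt_one (hκ : 0 < κ) (hc : 0 < c) {t : ℝ} (ht : t ≠ 0) : logCutoff κ c t < 1 := by
  refine Real.smoothTransition.lt_one_of_lt_one (sub_lt_self 1 (mul_pos hκ (Real.log_pos ?_)))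
  have : 0 < c * t ^ 2 := by positivity
  linarith

theorem logCutoff_eq_zero (hκ : 0 < κ) (hc : 0 < c) {t : ℝ}
    (ht : Real.exp (1 / κ) ≤ 1 + c * t ^ 2) : logCutoff κ c t = 0 := by
  refine Real.smoothTransition.zero_of_nonpos (sub_nonpos.2 ?_)
  rw [← div_le_iff₀' hκ]
  exact (Real.le_log_iff_exp_le (by positivity)).2 ht

theorem antitoneOn_logCutoff (hκ : 0 < κ) (hc : 0 < c) :
    AntitoneOn (logCutoff κ c) (Set.Ici 0) := fun s (hs : 0 ≤ s) t _ hst =>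
  Real.smoothTransition.monotone (by gcongr)

theorem hasDerivAt_logCutoff (hc : 0 < c) (t : ℝ) :
    HasDerivAt (logCutoff κ c)
      (deriv Real.smoothTransition (1 - κ * Real.log (1 + c * t ^ 2)) *
        -(κ * (c * (2 * t) / (1 + c * t ^ 2)))) t := by
  have hquad : HasDerivAt (fun t : ℝ => 1 + c * t ^ 2) (c * (2 * t)) t := by
    simpa using ((hasDerivAt_pow 2 t).const_mul c).const_add 1
  have hlog : HasDerivAt (fun t : ℝ => 1 - κ * Real.log (1 + c * t ^ 2))
      (-(κ * (c * (2 * t) / (1 + c * t ^ 2)))) t := by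
    simpa using ((hquad.log (by positivity)).const_mul κ).const_sub 1
  exact ((Real.smoothTransition.contDiff (n := 1)).differentiable one_ne_zero
    _).hasDerivAt.comp t hlog

theorem abs_mul_deriv_logCutoff_le (hκ : 0 < κ) (hc : 0 < c) {K : ℝ}
    (hK : ∀ x, |deriv Real.smoothTransition x| ≤ K) (t : ℝ) :
    |t * deriv (logCutoff κ c) t| ≤ 2 * κ * K := by
  have hden : 0 < 1 + c * t ^ 2 := by positivity
  have hfrac : c * t ^ 2 / (1 + c * t ^ 2) ≤ 1 := by
    rw [div_le_one hden]; linarith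
  rw [(hasDerivAt_logCutoff hc t).deriv]
  set d := deriv Real.smoothTransition (1 - κ * Real.log (1 + c * t ^ 2))
  calc |t * (d * -(κ * (c * (2 * t) / (1 + c * t ^ 2))))|
      = |-(2 * κ * (c * t ^ 2 / (1 + c * t ^ 2)) * d)| := by congr 1; ring
    _ = 2 * κ * (c * t ^ 2 / (1 + c * t ^ 2)) * |d| := by
      rw [abs_neg, abs_mul, abs_of_nonneg (by positivity)]
    _ ≤ 2 * κ * 1 * K := by gcongr; exact hK _
    _ = 2 * κ * K := by ring

end LogCutoff

theorem exists_isSlowCutoff {η ρ : ℝ} (hη : 0 < η) (hρ : 0 < ρ) : ∃ ψ, IsSlowCutoff ψ η ρ := by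
  obtain ⟨K, hK, hbound⟩ := exists_abs_deriv_smoothTransition_le
  set κ : ℝ := η / (2 * K) with hκ
  have hκ₀ : 0 < κ := by positivity
  have hexp : 1 < Real.exp (1 / κ) := Real.one_lt_exp_iff.2 (by positivity)
  -- `c` is chosen so that `κ log(1 + c ρ²) = 1`
  set c : ℝ := (Real.exp (1 / κ) - 1) / ρ ^ 2 with hc
  have hc₀ : 0 < c := div_pos (sub_pos.2 hexp) (by positivity)
  refine ⟨logCutoff κ c, contDiff_logCutoff hc₀, by simp [logCutoff],
    fun t => Real.smoothTransition.nonneg _, fun t => logCutoff_lt_one hκ₀ hc₀,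
    fun t ht => logCutoff_eq_zero hκ₀ hc₀ ?_, antitoneOn_logCutoff hκ₀ hc₀, fun t => ?_⟩
  · calc Real.exp (1 / κ) = 1 + c * ρ ^ 2 := by rw [hc]; field_simp; ring
      _ ≤ 1 + c * t ^ 2 := by gcongr
  · calc |t * deriv (logCutoff κ c) t| ≤ 2 * κ * K := abs_mul_deriv_logCutoff_le hκ₀ hc₀ hbound t
      _ = η := by rw [hκ]; field_simp

namespace IsSlowCutoff

variable {ψ : ℝ → ℝ} {η ρ : ℝ}

theorem le_one (h : IsSlowCutoff ψ η ρ) (t : ℝ) : ψ t ≤ 1 := by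
  rcases eq_or_ne t 0 with rfl | ht
  · exact h.apply_zero.le
  · exact (h.lt_one t ht).le

theorem antitone_sq (h : IsSlowCutoff ψ η ρ) {p q : ℝ} (hq : 0 ≤ q) (hqp : q ≤ p) :
    ψ (p ^ 2) ≤ ψ (q ^ 2) :=
  h.antitoneOn (Set.mem_Ici.2 (sq_nonneg q)) (Set.mem_Ici.2 (sq_nonneg p)) (by gcongr)

theorem monotoneOn_one_sub_mul (h : IsSlowCutoff ψ η ρ) :
    MonotoneOn (fun t => (1 - ψ (t ^ 2)) * t) (Set.Ici 0) := fun q (hq : 0 ≤ q) _ _ hqp =>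
  mul_le_mul (sub_le_sub_left (h.antitone_sq hq hqp) 1) hqp hq (sub_nonneg.2 (h.le_one _))

theorem one_sub_mul_sub_le (h : IsSlowCutoff ψ η ρ) (hη : 2 * η ≤ 1) {p q : ℝ} (hqp : q ≤ p) :
    (1 - ψ (p ^ 2)) * p - (1 - ψ (q ^ 2)) * q ≤ 2 * (p - q) := by
  have hderiv (t : ℝ) : HasDerivAt (fun t => (1 - ψ (t ^ 2)) * t)
      (-(deriv ψ (t ^ 2) * (2 * t)) * t + (1 - ψ (t ^ 2))) t := by
    have hsq : HasDerivAt (fun t : ℝ => ψ (t ^ 2)) (deriv ψ (t ^ 2) * (2 * t)) t :=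
      (h.contDiff.differentiable (by simp) _).hasDerivAt.comp t (by simpa using hasDerivAt_pow 2 t)
    simpa using (hsq.const_sub 1).fun_mul (hasDerivAt_id' t)
  refine image_sub_le_mul_sub_of_deriv_le (fun t => (hderiv t).differentiableAt) (fun t => ?_) hqp
  rw [(hderiv t).deriv]
  linarith [(abs_le.1 (h.abs_mul_deriv_le (t ^ 2))).1, h.nonneg (t ^ 2)]

end IsSlowCutoff

/-! ### Radial vector fields -/

section Radial

variable {X : Type*} [NormedAddCommGroup X] [InnerProductSpace ℝ X]

/-- The radial vector field `ψ(‖z‖²) z`. -/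
def radial (ψ : ℝ → ℝ) (z : X) : X := ψ (‖z‖ ^ 2) • z

/-- The derivative of `radial ψ` at `z`. -/
def radialDeriv (ψ : ℝ → ℝ) (z : X) : X →L[ℝ] X :=
  ψ (‖z‖ ^ 2) • ContinuousLinearMap.id ℝ X +
    (2 * deriv ψ (‖z‖ ^ 2)) • (innerSL ℝ z).smulRight z

variable {ψ : ℝ → ℝ} {η ρ r : ℝ}

theorem radialDeriv_apply (ψ : ℝ → ℝ) (z v : X) :
    radialDeriv ψ z v = ψ (‖z‖ ^ 2) • v + (2 * deriv ψ (‖z‖ ^ 2) * inner ℝ z v) • z := by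
  simp [radialDeriv, smul_smul]

theorem contDiff_radial (hψ : ContDiff ℝ ∞ ψ) : ContDiff ℝ ∞ (radial (X := X) ψ) :=
  (hψ.comp (contDiff_norm_sq ℝ)).smul contDiff_id

theorem hasFDerivAt_radial {z : X} (hψ : DifferentiableAt ℝ ψ (‖z‖ ^ 2)) :
    HasFDerivAt (radial ψ) (radialDeriv ψ z) z := by
  have hnorm : HasFDerivAt (fun z : X => ‖z‖ ^ 2) (2 • innerSL ℝ z) z :=
    (hasStrictFDerivAt_norm_sq z).hasFDerivAt
  refine ((hψ.hasDerivAt.comp_hasFDerivAt z hnorm).smul (hasFDerivAt_id z)).congr_fderiv ?_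
  ext v
  simp [radialDeriv_apply]
  ring_nf

theorem norm_radialDeriv_sub_le (hψ : IsSlowCutoff ψ η ρ) (z v : X) :
    ‖radialDeriv ψ z v - ψ (‖z‖ ^ 2) • v‖ ≤ 2 * η * ‖v‖ := by
  have hslow := hψ.abs_mul_deriv_le (‖z‖ ^ 2)
  rw [abs_mul, abs_of_nonneg (sq_nonneg ‖z‖)] at hslow
  rw [radialDeriv_apply, add_sub_cancel_left, norm_smul, Real.norm_eq_abs, abs_mul, abs_mul,
    abs_two]
  calc 2 * |deriv ψ (‖z‖ ^ 2)| * |inner ℝ z v| * ‖z‖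
      ≤ 2 * |deriv ψ (‖z‖ ^ 2)| * (‖z‖ * ‖v‖) * ‖z‖ := by
        gcongr; exact abs_real_inner_le_norm z v
    _ = 2 * (‖z‖ ^ 2 * |deriv ψ (‖z‖ ^ 2)|) * ‖v‖ := by ring
    _ ≤ 2 * η * ‖v‖ := by gcongr

theorem radial_eq_zero (hψ : IsSlowCutoff ψ η (r ^ 2)) (hr : 0 ≤ r) {z : X} (hz : r ≤ ‖z‖) :
    radial ψ z = 0 := by
  rw [radial, hψ.eq_zero _ (by gcongr), zero_smul]

theorem norm_radial_le (hψ : IsSlowCutoff ψ η (r ^ 2)) (hr : 0 ≤ r) (z : X) :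
    ‖radial ψ z‖ ≤ r := by
  rcases le_total r ‖z‖ with hz | hz
  · rwa [radial_eq_zero hψ hr hz, norm_zero]
  · rw [radial, norm_smul, Real.norm_of_nonneg (hψ.nonneg _)]
    exact (mul_le_of_le_one_left (norm_nonneg z) (hψ.le_one _)).trans hz

theorem norm_sq_smul_sub_smul_le {a b : ℝ} (ha : a ∈ Set.Icc (0 : ℝ) 1)
    (hb₀ : 0 ≤ b) {x y : X} (hlow : b * ‖y‖ ≤ a * ‖x‖)
    (hup : a * ‖x‖ - b * ‖y‖ ≤ 2 * (‖x‖ - ‖y‖)) :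
    ‖a • x - b • y‖ ^ 2 ≤ 2 * inner ℝ (a • x - b • y) (x - y) := by
  obtain ⟨ha₀, ha₁⟩ := ha
  rw [norm_sub_sq_real, inner_sub_left, inner_sub_right, inner_sub_right]
  simp only [norm_smul, real_inner_smul_left, real_inner_smul_right, real_inner_self_eq_norm_sq,
    Real.norm_eq_abs, abs_of_nonneg ha₀, abs_of_nonneg hb₀, real_inner_comm x y]
  obtain ⟨ht, ht'⟩ := abs_le.1 (abs_real_inner_le_norm x y)
  set t := inner ℝ x y
  have hp := norm_nonneg x
  have hq := norm_nonneg y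
  set p := ‖x‖
  set q := ‖y‖
  -- the difference of the two sides is affine in `t` and nonnegative at `t = ± p q`
  have hpos : 0 ≤ (2 * (p - q) - (a * p - b * q)) * (a * p - b * q) :=
    mul_nonneg (sub_nonneg.2 hup) (sub_nonneg.2 hlow)
  have hneg : 0 ≤ (2 * (p + q) - (a * p + b * q)) * (a * p + b * q) :=
    mul_nonneg (by nlinarith) (by positivity)
  rcases le_total 0 (2 * a * b - 2 * (a + b)) with hs | hs
  · nlinarith [mul_nonneg hs (by linarith : 0 ≤ t + p * q)]
  · nlinarith [mul_nonneg (neg_nonneg.2 hs) (by linarith : 0 ≤ p * q - t)]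

theorem norm_sq_complement_sub_le (hψ : IsSlowCutoff ψ η ρ) (hη : 2 * η ≤ 1) (x y : X) :
    ‖(x - y) - (radial ψ x - radial ψ y)‖ ^ 2 ≤
      2 * inner ℝ ((x - y) - (radial ψ x - radial ψ y)) (x - y) := by
  wlog hxy : ‖y‖ ≤ ‖x‖ generalizing x y
  · have hswap : (x - y) - (radial ψ x - radial ψ y) =
        -((y - x) - (radial ψ y - radial ψ x)) := by abel
    rw [hswap, norm_neg, ← neg_sub y x, inner_neg_neg]
    exact this y x (le_of_not_ge hxy)
  have hcoeff (z : X) : 1 - ψ (‖z‖ ^ 2) ∈ Set.Icc (0 : ℝ) 1 :=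
    ⟨sub_nonneg.2 (hψ.le_one _), sub_le_self 1 (hψ.nonneg _)⟩
  have hfield : (x - y) - (radial ψ x - radial ψ y) =
      (1 - ψ (‖x‖ ^ 2)) • x - (1 - ψ (‖y‖ ^ 2)) • y := by
    simp only [radial, sub_smul, one_smul]; abel
  rw [hfield]
  exact norm_sq_smul_sub_smul_le (hcoeff x) (hcoeff y).1
    (hψ.monotoneOn_one_sub_mul (norm_nonneg y) (norm_nonneg x) hxy)
    (hψ.one_sub_mul_sub_le hη hxy)

theorem le_inner_complement_sub (hψ : IsSlowCutoff ψ η ρ) (x y : X) :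
    (1 - ψ ((‖x - y‖ / 2) ^ 2)) / 2 * ‖x - y‖ ^ 2 ≤
      inner ℝ ((x - y) - (radial ψ x - radial ψ y)) (x - y) := by
  wlog hxy : ‖y‖ ≤ ‖x‖ generalizing x y
  · have hswap : (x - y) - (radial ψ x - radial ψ y) =
        -((y - x) - (radial ψ y - radial ψ x)) := by abel
    rw [hswap, ← neg_sub y x, inner_neg_neg, norm_neg]
    exact this y x (le_of_not_ge hxy)
  have hanti : ψ (‖x‖ ^ 2) ≤ ψ (‖y‖ ^ 2) := hψ.antitone_sq (norm_nonneg y) hxy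
  have hanti' : ψ (‖x‖ ^ 2) ≤ ψ ((‖x - y‖ / 2) ^ 2) :=
    hψ.antitone_sq (by positivity) (by linarith [norm_sub_le x y])
  have hpolar : inner ℝ ((x - y) - (radial ψ x - radial ψ y)) (x - y) =
      (1 - ψ (‖x‖ ^ 2) + (1 - ψ (‖y‖ ^ 2))) / 2 * ‖x - y‖ ^ 2 +
        (ψ (‖y‖ ^ 2) - ψ (‖x‖ ^ 2)) / 2 * (‖x‖ ^ 2 - ‖y‖ ^ 2) := by
    rw [norm_sub_sq_real]
    simp only [radial, inner_sub_left, inner_sub_right, real_inner_smul_left,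
      real_inner_self_eq_norm_sq, real_inner_comm x y]
    ring
  have hsq : ‖y‖ ^ 2 ≤ ‖x‖ ^ 2 := by gcongr
  have hrest : 0 ≤ (ψ (‖y‖ ^ 2) - ψ (‖x‖ ^ 2)) / 2 * (‖x‖ ^ 2 - ‖y‖ ^ 2) :=
    mul_nonneg (by linarith) (sub_nonneg.2 hsq)
  rw [hpolar]
  nlinarith [sq_nonneg ‖x - y‖, hψ.le_one (‖y‖ ^ 2)]

theorem norm_radial_sub_le (hψ : IsSlowCutoff ψ η ρ) (hη : 2 * η ≤ 1) (x y : X) :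
    ‖radial ψ x - radial ψ y‖ ≤ 3 * ‖x - y‖ := by
  set g := (x - y) - (radial ψ x - radial ψ y) with hg
  have hsq : ‖g‖ ^ 2 ≤ 2 * (‖g‖ * ‖x - y‖) :=
    (norm_sq_complement_sub_le hψ hη x y).trans (by gcongr; exact real_inner_le_norm g (x - y))
  have hle : ‖g‖ ≤ 2 * ‖x - y‖ := by
    by_contra! hlt
    nlinarith [norm_nonneg (x - y)]
  calc ‖radial ψ x - radial ψ y‖ = ‖(x - y) - g‖ := by rw [hg, sub_sub_cancel]
    _ ≤ ‖x - y‖ + ‖g‖ := norm_sub_le _ _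
    _ ≤ 3 * ‖x - y‖ := by linarith

end Radial

/-! ### Periodization -/

section Periodize

variable {X Y : Type*} [NormedAddCommGroup X] [AddCommMonoid Y] {Γ : AddSubgroup X} {r : ℝ}
  {R : X → Y}

/-- The sum of the translates of `R` by `Γ`, used for `R` supported in a ball so small that these
translates have disjoint supports. -/
def periodize (Γ : AddSubgroup X) (R : X → Y) (x : X) : Y := ∑ᶠ γ : Γ, R (x - γ)

theorem periodize_add (x : X) {γ : X} (hγ : γ ∈ Γ) :
    periodize Γ R (x + γ) = periodize Γ R x := by
  refine (finsum_comp_equiv (Equiv.addRight (⟨γ, hγ⟩ : Γ))).symm.trans (finsum_congr fun γ' => ?_)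
  simp

theorem periodize_eq_zero (hR : ∀ z, r ≤ ‖z‖ → R z = 0) {x : X} (hx : ∀ γ ∈ Γ, r ≤ ‖x - γ‖) :
    periodize Γ R x = 0 :=
  finsum_eq_zero_of_forall_eq_zero fun γ => hR _ (hx γ γ.2)

theorem periodize_eq (hsep : ∀ γ ∈ Γ, γ ≠ 0 → 4 * r ≤ ‖γ‖) (hR : ∀ z, r ≤ ‖z‖ → R z = 0)
    {x γ : X} (hγ : γ ∈ Γ) (hx : ‖x - γ‖ ≤ 3 * r) : periodize Γ R x = R (x - γ) := by
  refine finsum_eq_single _ (⟨γ, hγ⟩ : Γ) fun γ' hne => hR _ ?_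
  have hdist := hsep _ (Γ.sub_mem γ'.2 hγ) (sub_ne_zero.2 fun h => hne (Subtype.ext h))
  have htri : ‖(γ' : X) - γ‖ ≤ ‖x - γ‖ + ‖x - γ'‖ := by
    rw [← sub_sub_sub_cancel_left _ _ x]
    exact norm_sub_le _ _
  linarith

theorem exists_periodize_eq (hsep : ∀ γ ∈ Γ, γ ≠ 0 → 4 * r ≤ ‖γ‖)
    (hR : ∀ z, r ≤ ‖z‖ → R z = 0) (x : X) :
    ∃ γ ∈ Γ, ∀ y, ‖y - x‖ ≤ r → periodize Γ R y = R (y - γ) := by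
  by_cases h : ∃ γ ∈ Γ, ‖x - γ‖ ≤ 2 * r
  · obtain ⟨γ, hγ, hx⟩ := h
    refine ⟨γ, hγ, fun y hy => periodize_eq hsep hR hγ ?_⟩
    linarith [norm_sub_le_norm_sub_add_norm_sub y x γ]
  · push Not at h
    have hfar (y : X) (hy : ‖y - x‖ ≤ r) (γ : X) (hγ : γ ∈ Γ) : r ≤ ‖y - γ‖ := by
      linarith [h γ hγ, norm_sub_le_norm_sub_add_norm_sub x y γ, norm_sub_rev x y]
    refine ⟨0, Γ.zero_mem, fun y hy => ?_⟩
    rw [periodize_eq_zero hR (hfar y hy), hR _ (hfar y hy 0 Γ.zero_mem)]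

theorem exists_periodize_eventuallyEq (hr : 0 < r) (hsep : ∀ γ ∈ Γ, γ ≠ 0 → 4 * r ≤ ‖γ‖)
    (hR : ∀ z, r ≤ ‖z‖ → R z = 0) (x : X) :
    ∃ γ ∈ Γ, periodize Γ R =ᶠ[nhds x] fun y => R (y - γ) := by
  obtain ⟨γ, hγ, h⟩ := exists_periodize_eq hsep hR x
  refine ⟨γ, hγ, ?_⟩
  filter_upwards [Metric.closedBall_mem_nhds x hr] with y hy
  exact h y (by rwa [← dist_eq_norm])

theorem contDiff_periodize {Y : Type*} [NormedAddCommGroup Y] [NormedSpace ℝ Y] [NormedSpace ℝ X]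
    {R : X → Y} (hr : 0 < r) (hsep : ∀ γ ∈ Γ, γ ≠ 0 → 4 * r ≤ ‖γ‖)
    (hR : ∀ z, r ≤ ‖z‖ → R z = 0) {m : WithTop ℕ∞} (hs : ContDiff ℝ m R) :
    ContDiff ℝ m (periodize Γ R) := by
  rw [contDiff_iff_contDiffAt]
  intro x
  obtain ⟨γ, -, h⟩ := exists_periodize_eventuallyEq hr hsep hR x
  exact (hs.comp (contDiff_id.sub contDiff_const)).contDiffAt.congr_of_eventuallyEq h

end Periodize

/-! ### Diagonal operators -/

section Diag

variable {ι : Type*} [Fintype ι]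

open Classical in
/-- The diagonal operator with entries `a`. -/
def diag (a : ι → ℝ) : EuclideanSpace ℝ ι →L[ℝ] EuclideanSpace ℝ ι :=
  Matrix.toEuclideanCLM (𝕜 := ℝ) (Matrix.diagonal a)

@[simp] theorem diag_apply (a : ι → ℝ) (v : EuclideanSpace ℝ ι) (i : ι) :
    diag a v i = a i * v i := by
  simp [diag, Matrix.ofLp_toEuclideanCLM, Matrix.mulVec_diagonal]

theorem norm_le_norm_of_forall_abs_le {v w : EuclideanSpace ℝ ι} (h : ∀ i, |v i| ≤ |w i|) :
    ‖v‖ ≤ ‖w‖ := by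
  rw [EuclideanSpace.norm_eq, EuclideanSpace.norm_eq]
  gcongr with i
  exact h i

theorem norm_diag_le {a : ι → ℝ} {C : ℝ} (hC : 0 ≤ C) {v : EuclideanSpace ℝ ι}
    (h : ∀ i, v i ≠ 0 → |a i| ≤ C) : ‖diag a v‖ ≤ C * ‖v‖ := by
  rw [← norm_smul_of_nonneg hC]
  refine norm_le_norm_of_forall_abs_le fun i => ?_
  rw [diag_apply, PiLp.smul_apply, smul_eq_mul, abs_mul, abs_mul, abs_of_nonneg hC]
  rcases eq_or_ne (v i) 0 with hi | hi
  · simp [hi]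
  · gcongr
    exact h i hi

theorem le_norm_diag {a : ι → ℝ} {C : ℝ} (hC : 0 ≤ C) {v : EuclideanSpace ℝ ι}
    (h : ∀ i, v i ≠ 0 → C ≤ |a i|) : C * ‖v‖ ≤ ‖diag a v‖ := by
  rw [← norm_smul_of_nonneg hC]
  refine norm_le_norm_of_forall_abs_le fun i => ?_
  rw [diag_apply, PiLp.smul_apply, smul_eq_mul, abs_mul, abs_mul, abs_of_nonneg hC]
  rcases eq_or_ne (v i) 0 with hi | hi
  · simp [hi]
  · gcongr
    exact h i hi

end Diag

/-! ### Strongly monotone maps and bounded perturbations -/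

theorem mul_norm_sq_le_inner_sub {X : Type*} [NormedAddCommGroup X] [InnerProductSpace ℝ X]
    {f : X → X} {f' : X → X →L[ℝ] X} (hf : ∀ x, HasFDerivAt f (f' x) x) {c : ℝ} {w : X}
    (h : ∀ x, c * ‖w‖ ^ 2 ≤ inner ℝ (f' x w) w) (y : X) :
    c * ‖w‖ ^ 2 ≤ inner ℝ (f (y + w) - f y) w := by
  have hderiv (t : ℝ) : HasDerivAt (fun t : ℝ => inner ℝ (f (y + t • w)) w)
      (inner ℝ (f' (y + t • w) w) w) t := by
    have hline : HasDerivAt (fun t : ℝ => y + t • w) w t := by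
      simpa using ((hasDerivAt_id t).smul_const w).const_add y
    simpa using ((hf _).comp_hasDerivAt t hline).inner ℝ (hasDerivAt_const t w)
  have hmvt := mul_sub_le_image_sub_of_le_deriv (fun t => (hderiv t).differentiableAt)
    (fun t => (h (y + t • w)).trans_eq (hderiv t).deriv.symm) zero_le_one
  simpa [inner_sub_left] using hmvt

theorem isProperMap_of_norm_sub_le {X Y : Type*} [TopologicalSpace X] [NormedAddCommGroup Y]
    [ProperSpace Y] {f g : X → Y} (hf : Continuous f) (hg : IsProperMap g) {C : ℝ}
    (h : ∀ x, ‖g x - f x‖ ≤ C) : IsProperMap f := by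
  rw [isProperMap_iff_tendsto_cocompact]
  refine ⟨hf, ?_⟩
  have hnorm : Filter.Tendsto (fun x => ‖g x‖ - C) (Filter.cocompact X) Filter.atTop :=
    Filter.tendsto_atTop_add_const_right _ _
      (tendsto_norm_cocompact_atTop.comp (isProperMap_iff_tendsto_cocompact.1 hg).2)
  rw [← Metric.cobounded_eq_cocompact, ← tendsto_norm_atTop_iff_cobounded]
  exact Filter.tendsto_atTop_mono
    (fun x => by linarith [norm_le_norm_add_norm_sub (f x) (g x), h x, norm_sub_rev (f x) (g x)])
    hnorm

/-! ### Dominated spectra -/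

/-- The eigenvalues `ν` of a diagonal partially hyperbolic operator, with the rates of
`IsPartiallyHyperbolic`. The label `τ` is `0`, `1`, `2` on the strongly stable, central and strongly
unstable coordinates respectively. -/
structure SpectralData (ι : Type*) where
  ν : ι → ℝ
  τ : ι → Fin 3
  ls : ℝ
  lc : ℝ
  lc' : ℝ
  lu : ℝ
  ls_nonneg : 0 ≤ ls
  ls_lt_lc : ls < lc
  lc_lt_one : lc < 1
  one_lt_lc' : 1 < lc'
  lc'_lt_lu : lc' < lu
  ν_ne_zero : ∀ i, ν i ≠ 0
  stable : ∀ i, τ i = 0 → |ν i| ≤ ls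
  center : ∀ i, τ i = 1 → ν i ∈ Set.Icc lc lc' ∧ ν i ≠ 1
  unstable : ∀ i, τ i = 2 → lu ≤ |ν i|

namespace SpectralData

variable {ι : Type*} (S : SpectralData ι)

/-- A quarter of the spectral gap: the size of the perturbations of the derivative which the
splitting tolerates. -/
def margin : ℝ := min (S.lc - S.ls) (S.lu - S.lc') / 4

theorem margin_pos : 0 < S.margin :=
  div_pos (lt_min (sub_pos.2 S.ls_lt_lc) (sub_pos.2 S.lc'_lt_lu)) four_pos

theorem four_mul_margin_le_left : 4 * S.margin ≤ S.lc - S.ls := by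
  rw [margin, mul_div_cancel₀ _ four_ne_zero]
  exact min_le_left _ _

theorem four_mul_margin_le_right : 4 * S.margin ≤ S.lu - S.lc' := by
  rw [margin, mul_div_cancel₀ _ four_ne_zero]
  exact min_le_right _ _

theorem margin_lt_lc : S.margin < S.lc := by
  linarith [S.four_mul_margin_le_left, S.margin_pos, S.ls_nonneg]

theorem lc_pos : 0 < S.lc := S.ls_nonneg.trans_lt S.ls_lt_lc

theorem lc'_pos : 0 < S.lc' := zero_lt_one.trans S.one_lt_lc'

/-- The central part of `ν - 1`. -/
def defect (i : ι) : ℝ := if S.τ i = 1 then S.ν i - 1 else 0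

theorem defect_of_ne {i : ι} (hi : S.τ i ≠ 1) : S.defect i = 0 := if_neg hi

theorem defect_of_eq {i : ι} (hi : S.τ i = 1) : S.defect i = S.ν i - 1 := if_pos hi

theorem abs_defect_le (i : ι) : |S.defect i| ≤ S.lc' := by
  by_cases hi : S.τ i = 1
  · obtain ⟨⟨hlow, hup⟩, -⟩ := S.center i hi
    rw [S.defect_of_eq hi, abs_le]
    constructor <;> linarith [S.lc_pos, S.one_lt_lc']
  · simpa [S.defect_of_ne hi] using S.lc'_pos.le

/-- The eigenvalues after moving the central ones to `1` by the proportion `c`. -/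
def damped (c : ℝ) (i : ι) : ℝ := S.ν i - c * S.defect i

theorem damped_mem_Icc {c : ℝ} (hc : c ∈ Set.Icc (0 : ℝ) 1) {i : ι} (hi : S.τ i = 1) :
    S.damped c i ∈ Set.Icc S.lc S.lc' := by
  have hconvex : S.damped c i = (1 - c) • S.ν i + c • 1 := by
    simp only [damped, S.defect_of_eq hi, smul_eq_mul]; ring
  rw [hconvex]
  exact convex_Icc _ _ (S.center i hi).1 ⟨S.lc_lt_one.le, S.one_lt_lc'.le⟩
    (sub_nonneg.2 hc.2) hc.1 (sub_add_cancel 1 c)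

/-- The coordinate subspace of the splitting with label `j`. -/
def block (j : Fin 3) : Submodule ℝ (EuclideanSpace ℝ ι) where
  carrier := {v | ∀ i, S.τ i ≠ j → v i = 0}
  add_mem' hv hw i hi := by simp [hv i hi, hw i hi]
  zero_mem' _ _ := rfl
  smul_mem' c v hv i hi := by simp [hv i hi]

theorem τ_eq_of_apply_ne_zero {j : Fin 3} {v : EuclideanSpace ℝ ι} (hv : v ∈ S.block j) {i : ι}
    (hi : v i ≠ 0) : S.τ i = j :=
  not_not.1 (mt (hv i) hi)

end SpectralData

/-! ### The model map -/

/-- A perturbation of a diagonal map, supported near the points of a discrete subgroup `Γ`. -/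
structure Model (ι : Type*) [Fintype ι] extends SpectralData ι where
  Γ : AddSubgroup (EuclideanSpace ℝ ι)
  r : ℝ
  ψ : ℝ → ℝ
  r_pos : 0 < r
  separated : ∀ γ ∈ Γ, γ ≠ 0 → 4 * r ≤ ‖γ‖
  cutoff : IsSlowCutoff ψ (toSpectralData.margin / (2 * lc')) (r ^ 2)

namespace Model

variable {ι : Type*} [Fintype ι] (𝓜 : Model ι)

theorem two_mul_slowness_le_one : 2 * (𝓜.margin / (2 * 𝓜.lc')) ≤ 1 := by
  have hlc' := 𝓜.lc'_pos
  rw [show 2 * (𝓜.margin / (2 * 𝓜.lc')) = 𝓜.margin / 𝓜.lc' by field_simp, div_le_one hlc']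
  linarith [𝓜.margin_lt_lc, 𝓜.lc_lt_one, 𝓜.one_lt_lc']

/-- The `Γ`-periodic vector field which is radial near each point of `Γ`. -/
def vectorField : EuclideanSpace ℝ ι → EuclideanSpace ℝ ι := periodize 𝓜.Γ (radial 𝓜.ψ)

theorem radial_eq_zero_of_le (z : EuclideanSpace ℝ ι) (hz : 𝓜.r ≤ ‖z‖) : radial 𝓜.ψ z = 0 :=
  radial_eq_zero 𝓜.cutoff 𝓜.r_pos.le hz

theorem contDiff_vectorField : ContDiff ℝ ∞ 𝓜.vectorField :=
  contDiff_periodize 𝓜.r_pos 𝓜.separated 𝓜.radial_eq_zero_of_le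
    (contDiff_radial 𝓜.cutoff.contDiff)

theorem norm_vectorField_le (x : EuclideanSpace ℝ ι) : ‖𝓜.vectorField x‖ ≤ 𝓜.r := by
  obtain ⟨γ, -, h⟩ := exists_periodize_eq 𝓜.separated 𝓜.radial_eq_zero_of_le x
  rw [vectorField, h x (by simpa using 𝓜.r_pos.le)]
  exact norm_radial_le 𝓜.cutoff 𝓜.r_pos.le _

theorem vectorField_eq_radial {x : EuclideanSpace ℝ ι} (hx : ‖x‖ ≤ 𝓜.r) :
    𝓜.vectorField x = radial 𝓜.ψ x := by
  rw [vectorField, periodize_eq 𝓜.separated 𝓜.radial_eq_zero_of_le 𝓜.Γ.zero_mem, sub_zero]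
  rw [sub_zero]
  linarith [𝓜.r_pos]

/-- The perturbation of strength `s`. At `s = 1` its derivative at `0` is the identity on the
centre. -/
def map (s : ℝ) (x : EuclideanSpace ℝ ι) : EuclideanSpace ℝ ι :=
  diag 𝓜.ν x - s • diag 𝓜.defect (𝓜.vectorField x)

/-- The derivative of `map s` at `γ + z`, for the point `γ` of `Γ` nearest to it. -/
def mapDeriv (s : ℝ) (z : EuclideanSpace ℝ ι) : EuclideanSpace ℝ ι →L[ℝ] EuclideanSpace ℝ ι :=
  diag 𝓜.ν - s • (diag 𝓜.defect).comp (radialDeriv 𝓜.ψ z)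

theorem contDiff_uncurry_map :
    ContDiff ℝ ∞ fun q : ℝ × EuclideanSpace ℝ ι => 𝓜.map q.1 q.2 := by
  unfold map
  have := 𝓜.contDiff_vectorField
  fun_prop

theorem contDiff_map (s : ℝ) : ContDiff ℝ ∞ (𝓜.map s) :=
  𝓜.contDiff_uncurry_map.comp₂ contDiff_const contDiff_id

theorem hasFDerivAt_map {x z : EuclideanSpace ℝ ι}
    (h : HasFDerivAt 𝓜.vectorField (radialDeriv 𝓜.ψ z) x) (s : ℝ) :
    HasFDerivAt (𝓜.map s) (𝓜.mapDeriv s z) x :=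
  (diag 𝓜.ν).hasFDerivAt.sub (((diag 𝓜.defect).hasFDerivAt.comp x h).const_smul s)

theorem hasFDerivAt_radial_cutoff (z : EuclideanSpace ℝ ι) :
    HasFDerivAt (radial 𝓜.ψ) (radialDeriv 𝓜.ψ z) z :=
  hasFDerivAt_radial (𝓜.cutoff.contDiff.differentiable (by simp) _)

theorem exists_hasFDerivAt_map (x : EuclideanSpace ℝ ι) :
    ∃ z, ∀ s, HasFDerivAt (𝓜.map s) (𝓜.mapDeriv s z) x := by
  obtain ⟨γ, -, h⟩ :=
    exists_periodize_eventuallyEq 𝓜.r_pos 𝓜.separated 𝓜.radial_eq_zero_of_le x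
  refine ⟨x - γ, 𝓜.hasFDerivAt_map (HasFDerivAt.congr_of_eventuallyEq ?_ h)⟩
  exact (𝓜.hasFDerivAt_radial_cutoff (x - γ)).comp x ((hasFDerivAt_id x).sub_const γ)

theorem hasFDerivAt_map_zero (s : ℝ) : HasFDerivAt (𝓜.map s) (𝓜.mapDeriv s 0) 0 := by
  refine 𝓜.hasFDerivAt_map ((𝓜.hasFDerivAt_radial_cutoff 0).congr_of_eventuallyEq ?_) s
  filter_upwards [Metric.closedBall_mem_nhds 0 𝓜.r_pos] with y hy
  exact 𝓜.vectorField_eq_radial (mem_closedBall_zero_iff.1 hy)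

@[simp] theorem map_zero_right (s : ℝ) : 𝓜.map s 0 = 0 := by
  rw [map, 𝓜.vectorField_eq_radial (norm_zero.trans_le 𝓜.r_pos.le)]
  simp [radial]

theorem map_apply_of_ne (s : ℝ) (x : EuclideanSpace ℝ ι) {i : ι} (hi : 𝓜.τ i ≠ 1) :
    𝓜.map s x i = 𝓜.ν i * x i := by
  simp [map, 𝓜.defect_of_ne hi]

theorem mapDeriv_apply_of_ne (s : ℝ) (z v : EuclideanSpace ℝ ι) {i : ι} (hi : 𝓜.τ i ≠ 1) :
    𝓜.mapDeriv s z v i = 𝓜.ν i * v i := by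
  simp [mapDeriv, 𝓜.defect_of_ne hi]

variable (s : unitInterval)

theorem norm_mapDeriv_sub_le (z v : EuclideanSpace ℝ ι) :
    ‖𝓜.mapDeriv s z v - diag (𝓜.damped (s * 𝓜.ψ (‖z‖ ^ 2))) v‖ ≤ 𝓜.margin * ‖v‖ := by
  have hsub : 𝓜.mapDeriv s z v - diag (𝓜.damped (s * 𝓜.ψ (‖z‖ ^ 2))) v =
      -((s : ℝ) • diag 𝓜.defect (radialDeriv 𝓜.ψ z v - 𝓜.ψ (‖z‖ ^ 2) • v)) := by
    ext i
    simp [mapDeriv, SpectralData.damped]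
    ring
  have hlc' := 𝓜.lc'_pos
  rw [hsub, norm_neg, norm_smul_of_nonneg s.2.1]
  calc s * ‖diag 𝓜.defect (radialDeriv 𝓜.ψ z v - 𝓜.ψ (‖z‖ ^ 2) • v)‖
      ≤ 1 * (𝓜.lc' * ‖radialDeriv 𝓜.ψ z v - 𝓜.ψ (‖z‖ ^ 2) • v‖) := by
        gcongr
        · exact s.2.2
        · exact norm_diag_le hlc'.le fun i _ => 𝓜.abs_defect_le i
    _ ≤ 1 * (𝓜.lc' * (2 * (𝓜.margin / (2 * 𝓜.lc')) * ‖v‖)) := by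
        gcongr
        exact norm_radialDeriv_sub_le 𝓜.cutoff z v
    _ = 𝓜.margin * ‖v‖ := by field_simp

theorem damped_cutoff_mem_Icc (t : ℝ) {i : ι} (hi : 𝓜.τ i = 1) :
    𝓜.damped (s * 𝓜.ψ t) i ∈ Set.Icc 𝓜.lc 𝓜.lc' :=
  𝓜.damped_mem_Icc ⟨mul_nonneg s.2.1 (𝓜.cutoff.nonneg t),
    mul_le_one₀ s.2.2 (𝓜.cutoff.nonneg t) (𝓜.cutoff.le_one t)⟩ hi

variable {v : EuclideanSpace ℝ ι}

theorem norm_mapDeriv_le (z : EuclideanSpace ℝ ι) (hv : v ∈ 𝓜.block 1) :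
    ‖𝓜.mapDeriv s z v‖ ≤ (𝓜.lc' + 𝓜.margin) * ‖v‖ := by
  have hdiag : ‖diag (𝓜.damped (s * 𝓜.ψ (‖z‖ ^ 2))) v‖ ≤ 𝓜.lc' * ‖v‖ :=
    norm_diag_le 𝓜.lc'_pos.le fun i hi => by
      have hmem := 𝓜.damped_cutoff_mem_Icc s (‖z‖ ^ 2) (𝓜.τ_eq_of_apply_ne_zero hv hi)
      rw [abs_of_nonneg (𝓜.lc_pos.le.trans hmem.1)]
      exact hmem.2
  linarith [𝓜.norm_mapDeriv_sub_le s z v, norm_le_norm_add_norm_sub' (𝓜.mapDeriv s z v)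
    (diag (𝓜.damped (s * 𝓜.ψ (‖z‖ ^ 2))) v)]

theorem le_inner_mapDeriv (z : EuclideanSpace ℝ ι) (hv : v ∈ 𝓜.block 1) :
    (𝓜.lc - 𝓜.margin) * ‖v‖ ^ 2 ≤ inner ℝ (𝓜.mapDeriv s z v) v := by
  set w := diag (𝓜.damped (s * 𝓜.ψ (‖z‖ ^ 2))) v with hw
  have hdiag : 𝓜.lc * ‖v‖ ^ 2 ≤ inner ℝ w v := by
    rw [EuclideanSpace.norm_sq_eq, Finset.mul_sum, PiLp.inner_apply]
    refine Finset.sum_le_sum fun i _ => ?_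
    simp only [hw, diag_apply, Real.norm_eq_abs, sq_abs, RCLike.inner_apply, conj_trivial]
    rcases eq_or_ne (v i) 0 with hi | hi
    · simp [hi]
    · have := (𝓜.damped_cutoff_mem_Icc s (‖z‖ ^ 2) (𝓜.τ_eq_of_apply_ne_zero hv hi)).1
      nlinarith [sq_nonneg (v i)]
  have herror : -(𝓜.margin * ‖v‖ * ‖v‖) ≤ inner ℝ (𝓜.mapDeriv s z v - w) v :=
    (neg_le_neg (by gcongr; exact 𝓜.norm_mapDeriv_sub_le s z v)).trans
      (abs_le.1 (abs_real_inner_le_norm (𝓜.mapDeriv s z v - w) v)).1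
  rw [inner_sub_left] at herror
  linarith

theorem le_norm_mapDeriv (z : EuclideanSpace ℝ ι) (hv : v ∈ 𝓜.block 1) :
    (𝓜.lc - 𝓜.margin) * ‖v‖ ≤ ‖𝓜.mapDeriv s z v‖ := by
  rcases (norm_nonneg v).eq_or_lt with h | h
  · rw [← h, mul_zero]
    exact norm_nonneg _
  · refine le_of_mul_le_mul_right ?_ h
    linarith [𝓜.le_inner_mapDeriv s z hv, real_inner_le_norm (𝓜.mapDeriv s z v) v]

theorem injective_mapDeriv (z : EuclideanSpace ℝ ι) : Function.Injective (𝓜.mapDeriv s z) := by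
  rw [injective_iff_map_eq_zero]
  intro v hv
  have hcentral : v ∈ 𝓜.block 1 := fun i hi => by
    simpa [hv, 𝓜.ν_ne_zero i] using (𝓜.mapDeriv_apply_of_ne s z v hi).symm
  have hle := 𝓜.le_norm_mapDeriv s z hcentral
  rw [hv, norm_zero] at hle
  exact norm_le_zero_iff.1 (nonpos_of_mul_nonpos_right hle (sub_pos.2 𝓜.margin_lt_lc))

/-- `mapDeriv` as a linear automorphism. -/
def mapDerivEquiv (z : EuclideanSpace ℝ ι) : EuclideanSpace ℝ ι ≃L[ℝ] EuclideanSpace ℝ ι :=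
  (LinearEquiv.ofInjectiveEndo (𝓜.mapDeriv s z : EuclideanSpace ℝ ι →ₗ[ℝ] EuclideanSpace ℝ ι)
    (𝓜.injective_mapDeriv s z)).toContinuousLinearEquiv

theorem coe_mapDerivEquiv (z : EuclideanSpace ℝ ι) :
    (𝓜.mapDerivEquiv s z : EuclideanSpace ℝ ι →L[ℝ] EuclideanSpace ℝ ι) = 𝓜.mapDeriv s z := rfl

theorem injective_map : Function.Injective (𝓜.map s) := by
  intro x y hxy
  have hcentral : x - y ∈ 𝓜.block 1 := fun i hi => by
    have hi' := 𝓜.map_apply_of_ne s x hi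
    rw [hxy, 𝓜.map_apply_of_ne s y hi] at hi'
    simp [mul_left_cancel₀ (𝓜.ν_ne_zero i) hi']
  choose z hz using 𝓜.exists_hasFDerivAt_map
  have hmono := mul_norm_sq_le_inner_sub (fun x => hz x s)
    (fun x => 𝓜.le_inner_mapDeriv s (z x) hcentral) y
  rw [add_sub_cancel, hxy, sub_self, inner_zero_left] at hmono
  have hsq := nonpos_of_mul_nonpos_right hmono (sub_pos.2 𝓜.margin_lt_lc)
  exact sub_eq_zero.1 (norm_eq_zero.1 (pow_eq_zero_iff two_ne_zero |>.1
    (hsq.antisymm (sq_nonneg _))))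

theorem isOpenMap_map : IsOpenMap (𝓜.map s) := by
  refine isOpenMap_iff_nhds_le.2 fun x => ?_
  obtain ⟨z, hz⟩ := 𝓜.exists_hasFDerivAt_map x
  have hstrict : HasStrictFDerivAt (𝓜.map s)
      (𝓜.mapDerivEquiv s z : EuclideanSpace ℝ ι →L[ℝ] EuclideanSpace ℝ ι) x := by
    rw [coe_mapDerivEquiv, ← (hz s).fderiv]
    exact (𝓜.contDiff_map s).contDiffAt.hasStrictFDerivAt (by simp)
  exact hstrict.map_nhds_eq_of_equiv.ge

theorem isProperMap_map : IsProperMap (𝓜.map s) := by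
  have hdiag : IsProperMap (diag 𝓜.ν) := by
    refine (LinearMap.isClosedEmbedding_of_injective
      (f := (diag 𝓜.ν : EuclideanSpace ℝ ι →ₗ[ℝ] EuclideanSpace ℝ ι)) ?_).isProperMap
    refine LinearMap.ker_eq_bot'.2 fun v hv => ?_
    ext i
    simpa [𝓜.ν_ne_zero i] using congr($hv i)
  refine isProperMap_of_norm_sub_le (𝓜.contDiff_map s).continuous hdiag (C := 𝓜.lc' * 𝓜.r)
    fun x => ?_
  have hlc' := 𝓜.lc'_pos
  rw [map, sub_sub_cancel, norm_smul_of_nonneg s.2.1]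
  refine (mul_le_of_le_one_left (norm_nonneg _) s.2.2).trans ?_
  refine (norm_diag_le hlc'.le fun i _ => 𝓜.abs_defect_le i).trans ?_
  gcongr
  exact 𝓜.norm_vectorField_le x

theorem surjective_map : Function.Surjective (𝓜.map s) :=
  Set.range_eq_univ.1 (IsClopen.eq_univ
    ⟨(𝓜.isProperMap_map s).isClosedMap.isClosed_range, (𝓜.isOpenMap_map s).isOpen_range⟩
    (Set.range_nonempty _))

/-- `map s` as a homeomorphism. -/
def homeo : EuclideanSpace ℝ ι ≃ₜ EuclideanSpace ℝ ι :=
  (Equiv.ofBijective (𝓜.map s)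
    ⟨𝓜.injective_map s, 𝓜.surjective_map s⟩).toHomeomorphOfContinuousOpen
    (𝓜.contDiff_map s).continuous (𝓜.isOpenMap_map s)

theorem contDiff_homeo_symm : ContDiff ℝ ∞ (𝓜.homeo s).symm := by
  choose z hz using 𝓜.exists_hasFDerivAt_map
  exact (𝓜.homeo s).contDiff_symm (f₀' := fun x => 𝓜.mapDerivEquiv s (z x))
    (fun x => hz x s) (𝓜.contDiff_map s)

end Model

/-! ### Descending to the torus -/

/-- The permutation of the base of a surjection `p` induced by a permutation of its source. -/
def descend {X Y : Type*} {p : X → Y} (hp : Function.Surjective p) (F : Equiv.Perm X)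
    (hF : ∀ x y, p (F x) = p (F y) ↔ p x = p y) : Equiv.Perm Y :=
  (Setoid.quotientKerEquivOfSurjective p hp).permCongr (Quotient.congr F fun x y => (hF x y).symm)

theorem descend_apply {X Y : Type*} {p : X → Y} (hp : Function.Surjective p) (F : Equiv.Perm X)
    (hF : ∀ x y, p (F x) = p (F y) ↔ p x = p y) (x : X) : descend hp F hF (p x) = p (F x) := by
  have hsymm : (Setoid.quotientKerEquivOfSurjective p hp).symm (p x) = Quotient.mk _ x :=
    (Equiv.symm_apply_eq _).2 rfl
  rw [descend, Equiv.permCongr_apply, hsymm]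
  rfl

theorem descend_symm_apply {X Y : Type*} {p : X → Y} (hp : Function.Surjective p)
    (F : Equiv.Perm X) (hF : ∀ x y, p (F x) = p (F y) ↔ p x = p y) (x : X) :
    (descend hp F hF).symm (p x) = p (F.symm x) := by
  rw [Equiv.symm_apply_eq, descend_apply, F.apply_symm_apply]

theorem isOpenQuotientMap_proj {n : ℕ} : IsOpenQuotientMap (proj (n := n)) :=
  (IsOpenQuotientMap.piMap fun _ => QuotientAddGroup.isOpenQuotientMap_mk).comp
    (EuclideanSpace.equiv (Fin n) ℝ).toHomeomorph.isOpenQuotientMap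

theorem proj_zero {n : ℕ} : proj (0 : E n) = 0 := by
  funext _
  simp [proj]

theorem proj_sub {n : ℕ} (x y : E n) : proj (x - y) = proj x - proj y := by
  funext i
  simp [proj]

theorem linMap_injective {n : ℕ} (A : Matrix.SpecialLinearGroup (Fin n) ℤ) :
    Function.Injective (linMap A) := by
  have hinv : (A⁻¹).1.map (Int.cast : ℤ → ℝ) * A.1.map (Int.cast : ℤ → ℝ) = 1 := by
    rw [← Matrix.map_mul_intCast, ← Matrix.SpecialLinearGroup.coe_mul, inv_mul_cancel,
      Matrix.SpecialLinearGroup.coe_one, Matrix.map_one _ Int.cast_zero Int.cast_one]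
  refine Function.LeftInverse.injective (g := linMap A⁻¹) fun x => ?_
  ext i
  simp only [linMap, Matrix.toLpLin_apply, Matrix.mulVec_mulVec, hinv, Matrix.one_mulVec]

theorem one_le_norm_of_proj_eq_zero {n : ℕ} {x : E n} (h : proj x = 0) (hx : x ≠ 0) :
    1 ≤ ‖x‖ := by
  obtain ⟨i, hi⟩ : ∃ i, x i ≠ 0 := by
    by_contra! hc
    exact hx (PiLp.ext hc)
  obtain ⟨m, hm⟩ := (AddCircle.coe_eq_zero_iff 1).1 (congrFun h i)
  rw [zsmul_one] at hm
  refine le_trans ?_ (PiLp.norm_apply_le x i)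
  rw [← hm, Real.norm_eq_abs, ← Int.cast_abs]
  exact_mod_cast Int.one_le_abs fun hm0 => hi (by rw [← hm, hm0, Int.cast_zero])

theorem toralAut_zero {n : ℕ} (A : Matrix.SpecialLinearGroup (Fin n) ℤ) : toralAut A 0 = 0 := by
  rw [← proj_zero, ← proj_linMap, map_zero]

theorem IsSmooth.continuous {n : ℕ} {f : Torus n → Torus n} (hf : IsSmooth f) : Continuous f := by
  obtain ⟨F, hF, hproj⟩ := hf
  rw [← isOpenQuotientMap_proj.continuous_comp_iff,
    show f ∘ proj = proj ∘ F from funext fun x => (hproj x).symm]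
  exact isOpenQuotientMap_proj.continuous.comp hF.continuous

theorem IsSmooth.continuous_torusDeriv {n : ℕ} {f : Torus n → Torus n} (hf : IsSmooth f) :
    Continuous (torusDeriv f) := by
  obtain ⟨F, hF⟩ := hf
  rw [← isOpenQuotientMap_proj.continuous_comp_iff,
    show torusDeriv f ∘ proj = fderiv ℝ F from funext fun x => torusDeriv_proj hF x]
  exact hF.1.continuous_fderiv (by simp)

/-! ### The perturbed toral automorphism -/

/-- A model map whose linear part is the automorphism `A` in the linear coordinates `T`, and whose
lattice is that of the torus. -/
structure ToralModel {n : ℕ} (A : Matrix.SpecialLinearGroup (Fin n) ℤ) (ι : Type*) [Fintype ι]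
    extends Model ι where
  T : E n ≃L[ℝ] EuclideanSpace ℝ ι
  T_linMap : ∀ x, T (linMap A x) = diag ν (T x)
  mem_Γ : ∀ y, y ∈ Γ ↔ proj (T.symm y) = 0

namespace ToralModel

variable {n : ℕ} {A : Matrix.SpecialLinearGroup (Fin n) ℤ} {ι : Type*} [Fintype ι]
  (𝓣 : ToralModel A ι)

variable (s : unitInterval)

/-- The lift of the perturbed automorphism to `ℝⁿ`. -/
def lift : Equiv.Perm (E n) := 𝓣.T.symm.toEquiv.permCongr (𝓣.homeo s).toEquiv

theorem lift_apply (x : E n) : 𝓣.lift s x = 𝓣.T.symm (𝓣.map s (𝓣.T x)) := rfl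

theorem T_lift (x : E n) : 𝓣.T (𝓣.lift s x) = 𝓣.map s (𝓣.T x) :=
  𝓣.T.apply_symm_apply _

theorem contDiff_lift : ContDiff ℝ ∞ (𝓣.lift s) :=
  𝓣.T.symm.contDiff.comp ((𝓣.contDiff_map s).comp 𝓣.T.contDiff)

theorem contDiff_lift_symm : ContDiff ℝ ∞ (𝓣.lift s).symm :=
  𝓣.T.symm.contDiff.comp ((𝓣.contDiff_homeo_symm s).comp 𝓣.T.contDiff)

theorem lift_add (x : E n) {m : E n} (hm : proj m = 0) :
    𝓣.lift s (x + m) = 𝓣.lift s x + linMap A m := by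
  have hmem : 𝓣.T m ∈ 𝓣.Γ := (𝓣.mem_Γ _).2 (by rwa [ContinuousLinearEquiv.symm_apply_apply])
  apply 𝓣.T.injective
  rw [map_add 𝓣.T, T_lift, T_lift, T_linMap, map_add 𝓣.T, Model.map, Model.map, Model.vectorField,
    periodize_add _ hmem, map_add]
  abel

theorem proj_lift_eq_iff (x y : E n) :
    proj (𝓣.lift s x) = proj (𝓣.lift s y) ↔ proj x = proj y := by
  constructor <;> intro h <;> rw [← sub_eq_zero, ← proj_sub] at h
  · obtain ⟨m, hm⟩ := LinearMap.injective_iff_surjective.1 (linMap_injective A)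
      (𝓣.lift s x - 𝓣.lift s y)
    have hproj : proj m = 0 := (toralAut A).injective (by rw [← proj_linMap, hm, h, toralAut_zero])
    have hlift : 𝓣.lift s x = 𝓣.lift s (y + m) := by
      rw [lift_add 𝓣 s y hproj, hm, add_sub_cancel]
    rw [(𝓣.lift s).injective hlift, proj_add, hproj, add_zero]
  · rw [← add_sub_cancel y x, lift_add 𝓣 s y h, proj_add, proj_linMap, h, toralAut_zero, add_zero]

/-- The perturbed automorphism of the torus. -/
def perm : Equiv.Perm (Torus n) := descend proj_surjective (𝓣.lift s) (𝓣.proj_lift_eq_iff s)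

theorem perm_proj (x : E n) : 𝓣.perm s (proj x) = proj (𝓣.lift s x) := descend_apply _ _ _ x

theorem isSmoothLift_lift : IsSmoothLift (𝓣.lift s) (𝓣.perm s) :=
  ⟨𝓣.contDiff_lift s, fun x => (𝓣.perm_proj s x).symm⟩

theorem isDiffeo_perm : IsDiffeo (𝓣.perm s) :=
  ⟨⟨𝓣.lift s, 𝓣.isSmoothLift_lift s⟩, ⟨(𝓣.lift s).symm, 𝓣.contDiff_lift_symm s,
    fun x => (descend_symm_apply proj_surjective (𝓣.lift s) (𝓣.proj_lift_eq_iff s) x).symm⟩⟩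

theorem perm_zero : 𝓣.perm s 0 = 0 := by
  rw [← proj_zero, perm_proj, lift_apply, map_zero, Model.map_zero_right, map_zero]

theorem torusDeriv_perm_of_hasFDerivAt {x : E n}
    {M : EuclideanSpace ℝ ι →L[ℝ] EuclideanSpace ℝ ι} (h : HasFDerivAt (𝓣.map s) M (𝓣.T x)) :
    torusDeriv (𝓣.perm s) (proj x) =
      ((𝓣.T.symm : EuclideanSpace ℝ ι →L[ℝ] E n).comp M).comp
        (𝓣.T : E n →L[ℝ] EuclideanSpace ℝ ι) := by
  rw [torusDeriv_proj (𝓣.isSmoothLift_lift s)]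
  exact (((𝓣.T.symm.hasFDerivAt (x := 𝓣.map s (𝓣.T x))).comp _ h).comp x
    (𝓣.T.hasFDerivAt (x := x))).fderiv

theorem exists_torusDeriv_perm (x : Torus n) :
    ∃ z, torusDeriv (𝓣.perm s) x =
      ((𝓣.T.symm : EuclideanSpace ℝ ι →L[ℝ] E n).comp (𝓣.mapDeriv s z)).comp
        (𝓣.T : E n →L[ℝ] EuclideanSpace ℝ ι) := by
  obtain ⟨x, rfl⟩ := proj_surjective x
  obtain ⟨z, hz⟩ := 𝓣.exists_hasFDerivAt_map (𝓣.T x)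
  exact ⟨z, 𝓣.torusDeriv_perm_of_hasFDerivAt s (hz s)⟩

theorem perm_eq_toralAut {x : E n} (h : (s : ℝ) • 𝓣.vectorField (𝓣.T x) = 0) :
    𝓣.perm s (proj x) = toralAut A (proj x) := by
  rw [perm_proj, ← proj_linMap]
  congr 1
  apply 𝓣.T.injective
  rw [T_lift, T_linMap, Model.map, ← map_smul, h, map_zero, sub_zero]

theorem perm_eq_toralAut_of_notMem {ε : ℝ} (hε : ∀ y, ‖y‖ < 𝓣.r → ‖𝓣.T.symm y‖ < ε)
    {x : Torus n} (hx : x ∉ proj '' Metric.ball (0 : E n) ε) : 𝓣.perm s x = toralAut A x := by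
  obtain ⟨x, rfl⟩ := proj_surjective x
  have hfar : ∀ γ ∈ 𝓣.Γ, 𝓣.r ≤ ‖𝓣.T x - γ‖ := by
    intro γ hγ
    by_contra! hlt
    have hnorm := hε _ hlt
    rw [map_sub, ContinuousLinearEquiv.symm_apply_apply, ← mem_ball_zero_iff] at hnorm
    refine hx ⟨_, hnorm, ?_⟩
    rw [proj_sub, (𝓣.mem_Γ γ).1 hγ, sub_zero]
  refine 𝓣.perm_eq_toralAut s ?_
  rw [Model.vectorField, periodize_eq_zero 𝓣.radial_eq_zero_of_le hfar, smul_zero]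

theorem isotopic_perm : Isotopic (𝓣.perm 1) (toralAut A) := by
  have hproj : ∀ t ∈ Set.Icc (0 : ℝ) 1, (Set.projIcc 0 1 zero_le_one t : ℝ) = t :=
    fun t ht => by rw [Set.projIcc_of_mem zero_le_one ht]
  refine ⟨fun t => 𝓣.perm (unitInterval.symm (Set.projIcc 0 1 zero_le_one t)),
    fun q => 𝓣.T.symm (𝓣.map (1 - q.1) (𝓣.T q.2)), ?_, ?_, fun t _ => 𝓣.isDiffeo_perm _, ?_, ?_⟩
  · simp
  · ext1 x
    obtain ⟨x, rfl⟩ := proj_surjective x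
    exact 𝓣.perm_eq_toralAut _ (by simp)
  · exact (𝓣.T.symm.contDiff.comp (𝓣.contDiff_uncurry_map.comp₂
      (contDiff_const.sub contDiff_fst) (𝓣.T.contDiff.comp contDiff_snd))).contDiffOn
  · intro t ht x
    rw [perm_proj, lift_apply, unitInterval.coe_symm_eq, hproj t ht]

end ToralModel

/-! ### Invariant shears of triangular cocycles -/

section Shear

variable {R : Type*} [NormedRing R] [CompleteSpace R] {Y : Type*} [TopologicalSpace Y]
  [CompactSpace Y]

theorem exists_continuousMap_eq_add_mul_mul {f : Y → Y} (hf : Continuous f)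
    (U V W : C(Y, R)) (h : ∀ y, ‖V y‖ * ‖W y‖ < 1) :
    ∃ L : C(Y, R), ∀ y, L y = U y + V y * L (f y) * W y := by
  obtain ⟨q, hq1, hq⟩ : ∃ q : NNReal, q < 1 ∧ ∀ y, ‖V y‖₊ * ‖W y‖₊ ≤ q := by
    rcases isEmpty_or_nonempty Y with _ | _
    · exact ⟨0, zero_lt_one, isEmptyElim⟩
    · obtain ⟨y, -, hy⟩ := isCompact_univ.exists_isMaxOn Set.univ_nonempty
        (f := fun y => ‖V y‖₊ * ‖W y‖₊) (by fun_prop)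
      exact ⟨_, h y, fun z => hy (Set.mem_univ z)⟩
  let Φ (L : C(Y, R)) : C(Y, R) := U + V * L.comp ⟨f, hf⟩ * W
  have hcontr : ContractingWith q Φ := by
    refine ⟨hq1, LipschitzWith.of_dist_le_mul fun L L' => ?_⟩
    refine (ContinuousMap.dist_le (by positivity)).2 fun y => ?_
    calc dist (Φ L y) (Φ L' y) = ‖V y * (L (f y) - L' (f y)) * W y‖ := by
          simp [Φ, dist_eq_norm, mul_sub, sub_mul]
      _ ≤ ‖V y‖ * ‖L (f y) - L' (f y)‖ * ‖W y‖ := by grw [norm_mul_le, norm_mul_le]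
      _ = ‖V y‖ * ‖W y‖ * dist (L (f y)) (L' (f y)) := by rw [dist_eq_norm]; ring
      _ ≤ q * dist L L' := by
          gcongr
          · exact_mod_cast hq y
          · exact ContinuousMap.dist_apply_le_dist _
  exact ⟨hcontr.fixedPoint, fun y => (DFunLike.congr_fun hcontr.fixedPoint_isFixedPt y).symm⟩

/-- Relative to a decomposition `1 = P 0 + P 1 + P 2` of the identity, the cocycle `M` preserves the
range of `P 1` and acts as `D` modulo this range; it is less expanding on the range of `P 1` than
`D` is on the range of `P 2`, and less contracting than `D` is on the range of `P 0`. -/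
structure IsDominatedTriangular (P : Fin 3 → R) (D : Rˣ) (M : C(Y, R)) : Prop where
  idempotents : CompleteOrthogonalIdempotents P
  commute (j : Fin 3) : Commute (D : R) (P j)
  isUnit (y : Y) : IsUnit (M y)
  triangular (y : Y) : (1 - P 1) * M y = D * (1 - P 1)
  stable (y : Y) : ‖Ring.inverse (M y) * P 1‖ * ‖D * P 0‖ < 1
  unstable (y : Y) : ‖M y * P 1‖ * ‖↑D⁻¹ * P 2‖ < 1

namespace IsDominatedTriangular

variable {P : Fin 3 → R} {D : Rˣ} {M : C(Y, R)} (h : IsDominatedTriangular P D M)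

include h

omit [CompleteSpace R] [CompactSpace Y] in
theorem center_mul_mul_center_mul (y : Y) (a : R) :
    P 1 * (M y * (P 1 * a)) = M y * (P 1 * a) := by
  have hzero : (1 - P 1) * (M y * (P 1 * a)) = 0 := by
    rw [← mul_assoc, h.triangular, mul_assoc, ← mul_assoc _ (P 1),
      (h.idempotents.idem 1).one_sub_mul_self, zero_mul, mul_zero]
  rwa [sub_mul, one_mul, sub_eq_zero, eq_comm] at hzero

omit [CompleteSpace R] [CompactSpace Y] in
theorem center_mul_inverse_mul_center_mul (y : Y) (a : R) :
    P 1 * (Ring.inverse (M y) * (P 1 * a)) = Ring.inverse (M y) * (P 1 * a) := by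
  have hzero : D * ((1 - P 1) * (Ring.inverse (M y) * (P 1 * a))) = 0 := by
    rw [← mul_assoc, ← h.triangular, mul_assoc, ← mul_assoc (M y),
      Ring.mul_inverse_cancel _ (h.isUnit y), one_mul, ← mul_assoc,
      (h.idempotents.idem 1).one_sub_mul_self, zero_mul]
  rwa [D.mul_right_eq_zero, sub_mul, one_mul, sub_eq_zero, eq_comm] at hzero

theorem exists_stable_graph {f : Y → Y} (hf : Continuous f) : ∃ L : C(Y, R), ∀ y,
    P 1 * L y = L y ∧ L y * P 0 = L y ∧ M y * L y + P 1 * M y * P 0 = L (f y) * D := by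
  have hinv : Continuous fun y => Ring.inverse (M y) := continuous_iff_continuousAt.2 fun y => by
    obtain ⟨u, hu⟩ := h.isUnit y
    exact ContinuousAt.comp (hu ▸ NormedRing.inverse_continuousAt u) M.continuous.continuousAt
  let N : C(Y, R) := ⟨fun y => Ring.inverse (M y), hinv⟩
  have hMN (y : Y) (a : R) : M y * (N y * a) = a := by
    rw [← mul_assoc, show M y * N y = 1 from Ring.mul_inverse_cancel _ (h.isUnit y), one_mul]
  have hNP (y : Y) (a : R) : P 1 * (N y * (P 1 * a)) = N y * (P 1 * a) :=
    h.center_mul_inverse_mul_center_mul y a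
  obtain ⟨L, hL⟩ := exists_continuousMap_eq_add_mul_mul hf (-(N * .const Y (P 1) * M *
    .const Y (P 0))) (N * .const Y (P 1)) (.const Y (D * P 0)) h.stable
  replace hL (y : Y) : L y =
      -(N y * (P 1 * (M y * P 0))) + N y * (P 1 * (L (f y) * (D * P 0))) := by
    simpa [mul_assoc] using hL y
  have hcenter (y : Y) : P 1 * L y = L y := by
    rw [hL, mul_add, mul_neg, hNP, hNP]
  have hbase (y : Y) : L y * P 0 = L y := by
    rw [hL]
    simp only [add_mul, neg_mul, mul_assoc, (h.idempotents.idem 0).eq]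
  refine ⟨L, fun y => ⟨hcenter y, hbase y, ?_⟩⟩
  rw [hL y, mul_add, mul_neg, hMN, hMN, mul_assoc, neg_add_cancel_comm, ← mul_assoc, hcenter,
    (h.commute 0).eq, ← mul_assoc, hbase]

theorem exists_unstable_graph (f : Y ≃ₜ Y) : ∃ L : C(Y, R), ∀ y,
    P 1 * L y = L y ∧ L y * P 2 = L y ∧ M y * L y + P 1 * M y * P 2 = L (f y) * D := by
  let N : C(Y, R) := M.comp f.symm
  obtain ⟨L, hL⟩ := exists_continuousMap_eq_add_mul_mul f.symm.continuous
    (.const Y (P 1) * N * .const Y (P 2 * (↑D⁻¹ * P 2))) (N * .const Y (P 1))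
    (.const Y (↑D⁻¹ * P 2)) fun y => h.unstable (f.symm y)
  replace hL (y : Y) : L (f y) =
      P 1 * (M y * (P 2 * (↑D⁻¹ * P 2))) + M y * (P 1 * (L y * (↑D⁻¹ * P 2))) := by
    simpa [N, mul_assoc] using hL (f y)
  have hcenter (y : Y) : P 1 * L y = L y := by
    obtain ⟨y, rfl⟩ := f.surjective y
    rw [hL, mul_add, h.center_mul_mul_center_mul, ← mul_assoc, (h.idempotents.idem 1).eq]
  have hbase (y : Y) : L y * P 2 = L y := by
    obtain ⟨y, rfl⟩ := f.surjective y
    rw [hL]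
    simp only [add_mul, mul_assoc, (h.idempotents.idem 2).eq]
  have hconj : ↑D⁻¹ * (P 2 * D) = P 2 := by
    rw [← (h.commute 2).eq, D.inv_mul_cancel_left]
  refine ⟨L, fun y => ⟨hcenter y, hbase y, ?_⟩⟩
  rw [hL, add_mul]
  simp only [mul_assoc, hconj, (h.idempotents.idem 2).eq, hbase, hcenter]
  exact add_comm _ _

theorem exists_shear (f : Y ≃ₜ Y) : ∃ L : C(Y, R), ∀ y, P 1 * L y = L y ∧ L y * P 1 = 0 ∧
    M y * (1 + L y) = (1 + L (f y)) * (M y * P 1 + D * (1 - P 1)) := by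
  obtain ⟨Ls, hLs⟩ := h.exists_stable_graph f.continuous
  obtain ⟨Lu, hLu⟩ := h.exists_unstable_graph f
  have hcenter (y : Y) : (Ls y + Lu y) * P 1 = 0 := by
    rw [← (hLs y).2.1, ← (hLu y).2.1, add_mul, mul_assoc, mul_assoc,
      h.idempotents.ortho (by decide), h.idempotents.ortho (by decide), mul_zero, mul_zero,
      add_zero]
  refine ⟨Ls + Lu, fun y => ⟨?_, hcenter y, ?_⟩⟩
  · rw [ContinuousMap.add_apply, mul_add, (hLs y).1, (hLu y).1]
  have hsplit : 1 - P 1 = P 0 + P 2 := by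
    rw [← h.idempotents.complete, Fin.sum_univ_three]
    abel
  have hsum : M y * (Ls y + Lu y) + P 1 * M y * (1 - P 1) = (Ls (f y) + Lu (f y)) * D := by
    rw [hsplit, add_mul, ← (hLs y).2.2, ← (hLu y).2.2]
    noncomm_ring
  have hMP : P 1 * (M y * P 1) = M y * P 1 := by
    simpa using h.center_mul_mul_center_mul y 1
  have hcomm : (D : R) * (1 - P 1) = (1 - P 1) * D :=
    ((Commute.one_right _).sub_right (h.commute 1)).eq
  calc M y * (1 + (Ls y + Lu y))
      = M y + (Ls (f y) + Lu (f y)) * D - P 1 * M y * (1 - P 1) := by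
        rw [← hsum, mul_add, mul_one]
        abel
    _ = M y * P 1 + (1 - P 1) * M y + (Ls (f y) + Lu (f y)) * D := by
        rw [← hMP]
        noncomm_ring
    _ = (1 + (Ls (f y) + Lu (f y))) * (M y * P 1 + D * (1 - P 1)) := by
        rw [h.triangular, one_add_mul, mul_add, ← hMP, ← mul_assoc _ (P 1), hcenter, zero_mul,
          zero_add, hcomm, ← mul_assoc _ (1 - P 1), mul_sub _ 1, hcenter, mul_one, sub_zero]

end IsDominatedTriangular

end Shear

/-! ### The derivative of the perturbed automorphism -/

namespace SpectralData

variable {ι : Type*} [Fintype ι] (S : SpectralData ι)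

/-- The coordinate projection onto `block j`. -/
def blockProj (j : Fin 3) : EuclideanSpace ℝ ι →L[ℝ] EuclideanSpace ℝ ι :=
  diag fun i => if S.τ i = j then 1 else 0

theorem blockProj_apply (j : Fin 3) (v : EuclideanSpace ℝ ι) (i : ι) :
    S.blockProj j v i = if S.τ i = j then v i else 0 := by
  simp [blockProj]

theorem blockProj_mem (j : Fin 3) (v : EuclideanSpace ℝ ι) : S.blockProj j v ∈ S.block j :=
  fun i hi => by rw [blockProj_apply, if_neg hi]

theorem blockProj_eq_self {j : Fin 3} {v : EuclideanSpace ℝ ι} (hv : v ∈ S.block j) :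
    S.blockProj j v = v := by
  ext i
  rw [blockProj_apply, ite_eq_left_iff]
  exact fun hi => (hv i hi).symm

theorem blockProj_eq_zero {j k : Fin 3} (hjk : j ≠ k) {v : EuclideanSpace ℝ ι}
    (hv : v ∈ S.block k) : S.blockProj j v = 0 := by
  ext i
  rw [blockProj_apply, PiLp.zero_apply, ite_eq_right_iff]
  exact fun hi => hv i (hi.trans_ne hjk)

theorem norm_blockProj_le (j : Fin 3) (v : EuclideanSpace ℝ ι) : ‖S.blockProj j v‖ ≤ ‖v‖ := by
  simpa [blockProj] using norm_diag_le (v := v) zero_le_one fun i _ =>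
    show |if S.τ i = j then (1 : ℝ) else 0| ≤ 1 by split_ifs <;> simp

theorem completeOrthogonalIdempotents_blockProj : CompleteOrthogonalIdempotents S.blockProj :=
  CompleteOrthogonalIdempotents.iff_ortho_complete.2
    ⟨fun j k hjk => ContinuousLinearMap.ext fun v =>
      S.blockProj_eq_zero hjk (S.blockProj_mem k v), by
      ext v i
      simp [blockProj_apply]⟩

theorem commute_diag_blockProj (a : ι → ℝ) (j : Fin 3) : Commute (diag a) (S.blockProj j) := by
  ext v i
  simp [blockProj, mul_left_comm]

theorem norm_mul_blockProj_le {j : Fin 3} {C : ℝ} (hC : 0 ≤ C)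
    {B : EuclideanSpace ℝ ι →L[ℝ] EuclideanSpace ℝ ι} (h : ∀ v ∈ S.block j, ‖B v‖ ≤ C * ‖v‖) :
    ‖B * S.blockProj j‖ ≤ C :=
  ContinuousLinearMap.opNorm_le_bound _ hC fun v => (h _ (S.blockProj_mem j v)).trans (by
    gcongr
    exact S.norm_blockProj_le j v)

theorem orthogonalFamily_block :
    OrthogonalFamily ℝ (fun j => S.block j) fun j => (S.block j).subtypeₗᵢ := by
  intro j k hjk v w
  refine Finset.sum_eq_zero fun i _ => ?_
  by_cases hi : S.τ i = j
  · simp [w.2 i (hi.trans_ne hjk)]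
  · simp [v.2 i hi]

theorem isInternal_block {ι : Type*} [Finite ι] (S : SpectralData ι) :
    DirectSum.IsInternal S.block := by
  have := Fintype.ofFinite ι
  refine S.orthogonalFamily_block.isInternal_iff.2 ((Submodule.eq_top_iff'.2 fun v => ?_ :
    iSup S.block = ⊤) ▸ Submodule.top_orthogonal_eq_bot)
  have hv := congr($S.completeOrthogonalIdempotents_blockProj.complete v)
  rw [sum_apply, one_apply_eq_self] at hv
  rw [← hv]
  exact Submodule.sum_mem _ fun j _ => Submodule.mem_iSup_of_mem j (S.blockProj_mem j v)

theorem diag_mem_block {j : Fin 3} {v : EuclideanSpace ℝ ι} (hv : v ∈ S.block j) (a : ι → ℝ) :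
    diag a v ∈ S.block j := fun i hi => by rw [diag_apply, hv i hi, mul_zero]

/-- The diagonal operator of the eigenvalues as a unit. -/
def diagUnit : (EuclideanSpace ℝ ι →L[ℝ] EuclideanSpace ℝ ι)ˣ where
  val := diag S.ν
  inv := diag fun i => (S.ν i)⁻¹
  val_inv := by ext v i; simp [S.ν_ne_zero i]
  inv_val := by ext v i; simp [S.ν_ne_zero i]

theorem norm_diag_stable_le {v : EuclideanSpace ℝ ι} (hv : v ∈ S.block 0) :
    ‖diag S.ν v‖ ≤ S.ls * ‖v‖ :=
  norm_diag_le S.ls_nonneg fun i hi => S.stable i (S.τ_eq_of_apply_ne_zero hv hi)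

theorem le_norm_diag_unstable {v : EuclideanSpace ℝ ι} (hv : v ∈ S.block 2) :
    S.lu * ‖v‖ ≤ ‖diag S.ν v‖ :=
  le_norm_diag (S.lc'_pos.trans S.lc'_lt_lu).le
    fun i hi => S.unstable i (S.τ_eq_of_apply_ne_zero hv hi)

end SpectralData

namespace Model

variable {ι : Type*} [Fintype ι] (𝓜 : Model ι) (s : unitInterval) (z : EuclideanSpace ℝ ι)

theorem isUnit_mapDeriv : IsUnit (𝓜.mapDeriv s z) := ⟨(𝓜.mapDerivEquiv s z).toUnit, rfl⟩

theorem one_sub_blockProj_mul_mapDeriv :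
    (1 - 𝓜.blockProj 1) * 𝓜.mapDeriv s z = diag 𝓜.ν * (1 - 𝓜.blockProj 1) := by
  ext v i
  by_cases hi : 𝓜.τ i = 1 <;> simp [SpectralData.blockProj_apply, mapDeriv_apply_of_ne, hi]

theorem mapDeriv_mem_block {v : EuclideanSpace ℝ ι} (hv : v ∈ 𝓜.block 1) :
    𝓜.mapDeriv s z v ∈ 𝓜.block 1 := fun i hi => by
  rw [𝓜.mapDeriv_apply_of_ne s z v hi, hv i hi, mul_zero]

theorem norm_inverse_mapDeriv_mul_blockProj_le :
    ‖Ring.inverse (𝓜.mapDeriv s z) * 𝓜.blockProj 1‖ ≤ (𝓜.lc - 𝓜.margin)⁻¹ := by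
  have hpos := sub_pos.2 𝓜.margin_lt_lc
  refine 𝓜.norm_mul_blockProj_le (inv_nonneg.2 hpos.le) fun v hv => ?_
  set w := Ring.inverse (𝓜.mapDeriv s z) v
  have hw : 𝓜.mapDeriv s z w = v :=
    congr($(Ring.mul_inverse_cancel _ (𝓜.isUnit_mapDeriv s z)) v)
  have hcenter : w ∈ 𝓜.block 1 := fun i hi => by
    have h := 𝓜.mapDeriv_apply_of_ne s z w hi
    rw [hw, hv i hi, zero_eq_mul] at h
    exact h.resolve_left (𝓜.ν_ne_zero i)
  rw [le_inv_mul_iff₀ hpos, ← hw]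
  exact 𝓜.le_norm_mapDeriv s z hcenter

end Model

namespace ToralModel

variable {n : ℕ} {A : Matrix.SpecialLinearGroup (Fin n) ℤ} {ι : Type*} [Fintype ι]
  (𝓣 : ToralModel A ι) (s : unitInterval)

/-- The perturbed automorphism as a homeomorphism. -/
def permHomeo : Torus n ≃ₜ Torus n where
  toEquiv := 𝓣.perm s
  continuous_toFun := (𝓣.isDiffeo_perm s).1.continuous
  continuous_invFun := (𝓣.isDiffeo_perm s).2.continuous

/-- The derivative of the perturbed automorphism in the coordinates `T`. -/
def coordDeriv : C(Torus n, EuclideanSpace ℝ ι →L[ℝ] EuclideanSpace ℝ ι) where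
  toFun x := ((𝓣.T : E n →L[ℝ] EuclideanSpace ℝ ι).comp (torusDeriv (𝓣.perm s) x)).comp
    (𝓣.T.symm : EuclideanSpace ℝ ι →L[ℝ] E n)
  continuous_toFun := by
    have := (𝓣.isDiffeo_perm s).1.continuous_torusDeriv
    fun_prop

theorem T_torusDeriv (x : Torus n) (v : E n) :
    𝓣.T (torusDeriv (𝓣.perm s) x v) = 𝓣.coordDeriv s x (𝓣.T v) := by
  simp [coordDeriv]

theorem exists_coordDeriv_eq_mapDeriv (x : Torus n) :
    ∃ z, 𝓣.coordDeriv s x = 𝓣.mapDeriv s z := by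
  obtain ⟨z, hz⟩ := 𝓣.exists_torusDeriv_perm s x
  refine ⟨z, ?_⟩
  ext v : 1
  simp [coordDeriv, hz]

theorem isDominatedTriangular_coordDeriv :
    IsDominatedTriangular 𝓣.blockProj 𝓣.diagUnit (𝓣.coordDeriv s) where
  idempotents := 𝓣.completeOrthogonalIdempotents_blockProj
  commute := 𝓣.commute_diag_blockProj 𝓣.ν
  isUnit x := by
    obtain ⟨z, hz⟩ := 𝓣.exists_coordDeriv_eq_mapDeriv s x
    exact hz ▸ 𝓣.isUnit_mapDeriv s z
  triangular x := by
    obtain ⟨z, hz⟩ := 𝓣.exists_coordDeriv_eq_mapDeriv s x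
    exact hz ▸ 𝓣.one_sub_blockProj_mul_mapDeriv s z
  stable x := by
    obtain ⟨z, hz⟩ := 𝓣.exists_coordDeriv_eq_mapDeriv s x
    have hpos := sub_pos.2 𝓣.margin_lt_lc
    calc ‖Ring.inverse (𝓣.coordDeriv s x) * 𝓣.blockProj 1‖ * ‖diag 𝓣.ν * 𝓣.blockProj 0‖
        ≤ (𝓣.lc - 𝓣.margin)⁻¹ * 𝓣.ls := by
          rw [hz]
          gcongr
          · exact 𝓣.norm_inverse_mapDeriv_mul_blockProj_le s z
          · exact 𝓣.norm_mul_blockProj_le 𝓣.ls_nonneg fun v hv => 𝓣.norm_diag_stable_le hv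
      _ < 1 := by
          rw [inv_mul_lt_iff₀ hpos]
          linarith [𝓣.four_mul_margin_le_left, 𝓣.margin_pos]
  unstable x := by
    obtain ⟨z, hz⟩ := 𝓣.exists_coordDeriv_eq_mapDeriv s x
    have hlu := 𝓣.lc'_pos.trans 𝓣.lc'_lt_lu
    have hlow := 𝓣.lc'_pos.le.trans (le_add_of_nonneg_right 𝓣.margin_pos.le)
    calc ‖𝓣.coordDeriv s x * 𝓣.blockProj 1‖ * ‖(diag fun i => (𝓣.ν i)⁻¹) * 𝓣.blockProj 2‖
        ≤ (𝓣.lc' + 𝓣.margin) * 𝓣.lu⁻¹ := by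
          rw [hz]
          gcongr
          · exact 𝓣.norm_mul_blockProj_le hlow fun v hv => 𝓣.norm_mapDeriv_le s z hv
          · refine 𝓣.norm_mul_blockProj_le (inv_nonneg.2 hlu.le) fun v hv => ?_
            exact norm_diag_le (inv_nonneg.2 hlu.le) fun i hi => by
              rw [abs_inv]
              exact inv_anti₀ hlu (𝓣.unstable i (𝓣.τ_eq_of_apply_ne_zero hv hi))
      _ < 1 := by
          rw [mul_inv_lt_iff₀ hlu]
          linarith [𝓣.four_mul_margin_le_right, 𝓣.margin_pos]

end ToralModel

/-! ### The invariant splitting -/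

theorem isInternal_comap {R κ V W : Type*} [Ring R] [AddCommGroup V] [AddCommGroup W] [Module R V]
    [Module R W] [DecidableEq κ] {S : κ → Submodule R W} (hS : DirectSum.IsInternal S)
    (e : V ≃ₗ[R] W) : DirectSum.IsInternal fun j => (S j).comap (e : V →ₗ[R] W) := by
  rw [DirectSum.isInternal_submodule_iff_iSupIndep_and_iSup_eq_top] at hS ⊢
  let comap := (Submodule.orderIsoMapComap e).symm
  exact ⟨hS.1.map_orderIso comap, (comap.map_iSup S).symm.trans (by rw [hS.2, map_top])⟩

namespace ToralModel

variable {n : ℕ} {A : Matrix.SpecialLinearGroup (Fin n) ℤ} {ι : Type*} [Fintype ι]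
  (𝓣 : ToralModel A ι)

/-- The bundles of the linear splitting of `ℝⁿ`. -/
def linearBundle (j : Fin 3) : Submodule ℝ (E n) :=
  (𝓣.block j).comap (𝓣.T.toLinearEquiv : E n →ₗ[ℝ] EuclideanSpace ℝ ι)

theorem mem_linearBundle {j : Fin 3} {v : E n} : v ∈ 𝓣.linearBundle j ↔ 𝓣.T v ∈ 𝓣.block j :=
  Iff.rfl

theorem finrank_comap_block (e : E n ≃ₗ[ℝ] EuclideanSpace ℝ ι) (j : Fin 3) :
    Module.finrank ℝ ((𝓣.block j).comap (e : E n →ₗ[ℝ] EuclideanSpace ℝ ι)) =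
      Module.finrank ℝ (𝓣.linearBundle j) := by
  rw [linearBundle, Submodule.comap_equiv_eq_map_symm, Submodule.comap_equiv_eq_map_symm,
    LinearEquiv.finrank_map_eq, LinearEquiv.finrank_map_eq]

variable (s : unitInterval)

/-- The block-diagonal cocycle to which the derivative is conjugate. -/
def blockDeriv (x : Torus n) : EuclideanSpace ℝ ι →L[ℝ] EuclideanSpace ℝ ι :=
  𝓣.coordDeriv s x * 𝓣.blockProj 1 + diag 𝓣.ν * (1 - 𝓣.blockProj 1)

theorem blockDeriv_apply_center (x : Torus n) {v : EuclideanSpace ℝ ι} (hv : v ∈ 𝓣.block 1) :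
    𝓣.blockDeriv s x v = 𝓣.coordDeriv s x v := by
  simp [blockDeriv, 𝓣.blockProj_eq_self hv]

theorem blockDeriv_apply_of_ne (x : Torus n) {j : Fin 3} (hj : j ≠ 1) {v : EuclideanSpace ℝ ι}
    (hv : v ∈ 𝓣.block j) : 𝓣.blockDeriv s x v = diag 𝓣.ν v := by
  simp [blockDeriv, 𝓣.blockProj_eq_zero hj.symm hv]

theorem blockDeriv_mem_block (x : Torus n) {j : Fin 3} {v : EuclideanSpace ℝ ι}
    (hv : v ∈ 𝓣.block j) : 𝓣.blockDeriv s x v ∈ 𝓣.block j := by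
  rcases eq_or_ne j 1 with rfl | hj
  · obtain ⟨z, hz⟩ := 𝓣.exists_coordDeriv_eq_mapDeriv s x
    rw [𝓣.blockDeriv_apply_center s x hv, hz]
    exact 𝓣.mapDeriv_mem_block s z hv
  · rw [𝓣.blockDeriv_apply_of_ne s x hj hv]
    exact 𝓣.diag_mem_block hv 𝓣.ν

theorem injective_torusDeriv (x : Torus n) : Function.Injective (torusDeriv (𝓣.perm s) x) := by
  obtain ⟨z, hz⟩ := 𝓣.exists_torusDeriv_perm s x
  rw [hz]
  exact 𝓣.T.symm.injective.comp ((𝓣.injective_mapDeriv s z).comp 𝓣.T.injective)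

/-- A shear of the coordinates, into the centre, which conjugates the derivative to `blockDeriv`. -/
structure InvariantShear where
  L : C(Torus n, EuclideanSpace ℝ ι →L[ℝ] EuclideanSpace ℝ ι)
  center_mul : ∀ x, 𝓣.blockProj 1 * L x = L x
  mul_center : ∀ x, L x * 𝓣.blockProj 1 = 0
  conj : ∀ x, 𝓣.coordDeriv s x * (1 + L x) = (1 + L (𝓣.perm s x)) * 𝓣.blockDeriv s x

theorem nonempty_invariantShear : Nonempty (𝓣.InvariantShear s) := by
  obtain ⟨L, hL⟩ := (𝓣.isDominatedTriangular_coordDeriv s).exists_shear (𝓣.permHomeo s)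
  exact ⟨⟨L, fun x => (hL x).1, fun x => (hL x).2.1, fun x => (hL x).2.2⟩⟩

namespace InvariantShear

variable {𝓣 s} (σ : 𝓣.InvariantShear s)

theorem apply_mem_block (x : Torus n) (v : EuclideanSpace ℝ ι) : σ.L x v ∈ 𝓣.block 1 := by
  rw [← σ.center_mul x]
  exact 𝓣.blockProj_mem 1 _

theorem apply_eq_zero (x : Torus n) {v : EuclideanSpace ℝ ι} (hv : v ∈ 𝓣.block 1) :
    σ.L x v = 0 := by
  have h := congr($(σ.mul_center x) v)
  rwa [mul_apply_eq_comp, 𝓣.blockProj_eq_self hv] at h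

/-- The coordinates in which the derivative is `blockDeriv`. -/
def chart (x : Torus n) : E n ≃L[ℝ] EuclideanSpace ℝ ι :=
  𝓣.T.trans (.equivOfInverse (1 - σ.L x) (1 + σ.L x)
    (fun v => by simp [σ.apply_eq_zero x (σ.apply_mem_block x v)])
    (fun v => by simp [σ.apply_eq_zero x (σ.apply_mem_block x v)]))

theorem chart_apply (x : Torus n) (v : E n) : σ.chart x v = 𝓣.T v - σ.L x (𝓣.T v) := rfl

theorem chart_add_apply_chart (x : Torus n) (v : E n) :
    σ.chart x v + σ.L x (σ.chart x v) = 𝓣.T v := by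
  simp [chart_apply, σ.apply_eq_zero x (σ.apply_mem_block x _)]

theorem chart_torusDeriv (x : Torus n) (v : E n) :
    σ.chart (𝓣.perm s x) (torusDeriv (𝓣.perm s) x v) = 𝓣.blockDeriv s x (σ.chart x v) := by
  have hconj := congr($(σ.conj x) (σ.chart x v))
  simp only [mul_apply_eq_comp, add_apply, one_apply_eq_self, chart_add_apply_chart] at hconj
  rw [chart_apply, T_torusDeriv, hconj]
  simp [σ.apply_eq_zero _ (σ.apply_mem_block _ _)]

/-- The bundles of the invariant splitting. -/
def bundle (j : Fin 3) (x : Torus n) : Submodule ℝ (E n) :=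
  (𝓣.block j).comap ((σ.chart x).toLinearEquiv : E n →ₗ[ℝ] EuclideanSpace ℝ ι)

theorem mem_bundle {j : Fin 3} {x : Torus n} {v : E n} :
    v ∈ σ.bundle j x ↔ σ.chart x v ∈ 𝓣.block j := Iff.rfl

theorem finrank_bundle (j : Fin 3) (x : Torus n) :
    Module.finrank ℝ (σ.bundle j x) = Module.finrank ℝ (𝓣.linearBundle j) :=
  𝓣.finrank_comap_block _ j

theorem bundle_ne_bot {j : Fin 3} (hj : 𝓣.linearBundle j ≠ ⊥) (x : Torus n) :
    σ.bundle j x ≠ ⊥ := by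
  rwa [Ne, ← Submodule.finrank_eq_zero, σ.finrank_bundle, Submodule.finrank_eq_zero]

theorem isSubbundle_bundle (j : Fin 3) : IsSubbundle (σ.bundle j) := by
  refine ⟨⟨_, σ.finrank_bundle j⟩, (𝓣.block j).closed_of_finiteDimensional.preimage
    (f := fun q : Torus n × E n => σ.chart q.1 q.2) ?_⟩
  simp only [chart_apply]
  have := σ.L.continuous
  fun_prop

theorem map_bundle (j : Fin 3) (x : Torus n) :
    (σ.bundle j x).map (torusDeriv (𝓣.perm s) x : E n →ₗ[ℝ] E n) = σ.bundle j (𝓣.perm s x) := by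
  refine Submodule.eq_of_le_of_finrank_eq ?_ ?_
  · rintro - ⟨v, hv, rfl⟩
    rw [mem_bundle]
    exact σ.chart_torusDeriv x v ▸ 𝓣.blockDeriv_mem_block s x hv
  · rw [← (Submodule.equivMapOfInjective _ (𝓣.injective_torusDeriv s x) _).finrank_eq,
      finrank_bundle, finrank_bundle]

theorem isInternal_bundle (x : Torus n) :
    DirectSum.IsInternal ![σ.bundle 0 x, σ.bundle 1 x, σ.bundle 2 x] := by
  have h : DirectSum.IsInternal fun j => σ.bundle j x :=
    isInternal_comap 𝓣.isInternal_block (σ.chart x).toLinearEquiv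
  rwa [← FinVec.etaExpand_eq fun j => σ.bundle j x] at h

theorem bundle_one (x : Torus n) : σ.bundle 1 x = 𝓣.linearBundle 1 := by
  ext v
  rw [mem_bundle, mem_linearBundle]
  constructor <;> intro hv
  · rw [← σ.chart_add_apply_chart x, σ.apply_eq_zero x hv, add_zero]
    exact hv
  · rwa [chart_apply, σ.apply_eq_zero x hv, sub_zero]

end InvariantShear

end ToralModel

/-! ### An adapted metric -/

/-- The constant Riemannian metric induced by an injective linear map. -/
def constMetric {n : ℕ} {X : Type*} [NormedAddCommGroup X] [InnerProductSpace ℝ X]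
    (B : E n →L[ℝ] X) (hB : Function.Injective B) : RiemMetric n where
  inner _ := (innerSL ℝ (E := X)).bilinearComp B B
  symm _ v w := by simp [real_inner_comm]
  pos _ v hv := by
    have : B v ≠ 0 := (map_ne_zero_iff B hB).2 hv
    simpa using pow_pos (norm_pos_iff.2 this) 2
  smooth := contDiff_const

theorem constMetric_norm {n : ℕ} {X : Type*} [NormedAddCommGroup X] [InnerProductSpace ℝ X]
    (B : E n →L[ℝ] X) (hB : Function.Injective B) (x : Torus n) (v : E n) :
    (constMetric B hB).norm x v = ‖B v‖ := by
  change Real.sqrt (inner ℝ (B v) (B v)) = _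
  rw [real_inner_self_eq_norm_sq, Real.sqrt_sq (norm_nonneg _)]

namespace SpectralData

variable {ι : Type*} (S : SpectralData ι)

theorem lu_pos : 0 < S.lu := S.lc'_pos.trans S.lc'_lt_lu

theorem mul_one_add_le {a : ℝ} (ha : a ≤ S.lu) :
    a * (1 + S.margin / (2 * S.lu)) ≤ a + S.margin / 2 := by
  have hlu := S.lu_pos
  have hm := S.margin_pos
  calc a * (1 + S.margin / (2 * S.lu)) ≤ a + S.lu * (S.margin / (2 * S.lu)) := by
        rw [mul_one_add]
        gcongr
    _ = a + S.margin / 2 := by field_simp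

variable [Fintype ι]

/-- The operator which scales the central coordinates by `c`. -/
def centerScale (c : ℝ) : EuclideanSpace ℝ ι →L[ℝ] EuclideanSpace ℝ ι :=
  diag fun i => if S.τ i = 1 then c else 1

theorem centerScale_apply_center (c : ℝ) {v : EuclideanSpace ℝ ι} (hv : v ∈ S.block 1) :
    S.centerScale c v = c • v := by
  ext i
  by_cases hi : S.τ i = 1
  · simp [centerScale, hi]
  · simp [centerScale, hv i hi]

theorem centerScale_apply_of_ne (c : ℝ) {j : Fin 3} (hj : j ≠ 1) {v : EuclideanSpace ℝ ι}
    (hv : v ∈ S.block j) : S.centerScale c v = v := by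
  ext i
  by_cases hi : S.τ i = 1
  · simp [centerScale, hv i (hi.trans_ne hj.symm)]
  · simp [centerScale, hi]

theorem injective_centerScale {c : ℝ} (hc : c ≠ 0) : Function.Injective (S.centerScale c) := by
  rw [injective_iff_map_eq_zero]
  intro v hv
  ext i
  have hi := congr($hv i)
  rw [centerScale, diag_apply] at hi
  refine (mul_eq_zero.1 hi).resolve_left ?_
  split_ifs
  exacts [hc, one_ne_zero]

end SpectralData

namespace ToralModel

variable {n : ℕ} {A : Matrix.SpecialLinearGroup (Fin n) ℤ} {ι : Type*} [Fintype ι]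
  (𝓣 : ToralModel A ι) {s : unitInterval}

/-- The coordinates `T` with the central ones scaled by `c`. -/
def scaledCoords (c : ℝ) : E n →L[ℝ] EuclideanSpace ℝ ι :=
  (𝓣.centerScale c).comp (𝓣.T : E n →L[ℝ] EuclideanSpace ℝ ι)

theorem injective_scaledCoords {c : ℝ} (hc : c ≠ 0) : Function.Injective (𝓣.scaledCoords c) :=
  (𝓣.injective_centerScale hc).comp 𝓣.T.injective

namespace InvariantShear

variable {𝓣} (σ : 𝓣.InvariantShear s)

theorem norm_scaledCoords_center {c : ℝ} (hc : 0 ≤ c) {x : Torus n} {v : E n}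
    (hv : v ∈ σ.bundle 1 x) : ‖𝓣.scaledCoords c v‖ = c * ‖σ.chart x v‖ := by
  rw [scaledCoords, ContinuousLinearMap.comp_apply, ContinuousLinearEquiv.coe_coe,
    ← σ.chart_add_apply_chart x v, σ.apply_eq_zero x (σ.mem_bundle.1 hv), add_zero,
    𝓣.centerScale_apply_center c (σ.mem_bundle.1 hv), norm_smul_of_nonneg hc]

theorem scaledCoords_eq (c : ℝ) {j : Fin 3} (hj : j ≠ 1) {x : Torus n} {v : E n}
    (hv : v ∈ σ.bundle j x) :
    𝓣.scaledCoords c v = σ.chart x v + c • σ.L x (σ.chart x v) := by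
  rw [scaledCoords, ContinuousLinearMap.comp_apply, ContinuousLinearEquiv.coe_coe,
    ← σ.chart_add_apply_chart x v, map_add, 𝓣.centerScale_apply_of_ne c hj (σ.mem_bundle.1 hv),
    𝓣.centerScale_apply_center c (σ.apply_mem_block x _)]

theorem norm_chart_le (c : ℝ) {j : Fin 3} (hj : j ≠ 1) {x : Torus n} {v : E n}
    (hv : v ∈ σ.bundle j x) : ‖σ.chart x v‖ ≤ ‖𝓣.scaledCoords c v‖ := by
  have hproj : 𝓣.blockProj j (𝓣.scaledCoords c v) = σ.chart x v := by
    rw [σ.scaledCoords_eq c hj hv, map_add, map_smul, 𝓣.blockProj_eq_self (σ.mem_bundle.1 hv),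
      𝓣.blockProj_eq_zero hj (σ.apply_mem_block x _), smul_zero, add_zero]
  rw [← hproj]
  exact 𝓣.norm_blockProj_le j _

theorem norm_scaledCoords_le {c : ℝ} (hc : 0 ≤ c) {j : Fin 3} (hj : j ≠ 1) {x : Torus n} {v : E n}
    (hv : v ∈ σ.bundle j x) : ‖𝓣.scaledCoords c v‖ ≤ (1 + c * ‖σ.L x‖) * ‖σ.chart x v‖ := by
  rw [σ.scaledCoords_eq c hj hv]
  refine (norm_add_le _ _).trans ?_
  rw [norm_smul_of_nonneg hc, add_mul, one_mul, mul_assoc]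
  gcongr
  exact (σ.L x).le_opNorm _

/-- A scale at which the invariant bundles are almost flat over the linear ones. -/
def IsFlat (c : ℝ) : Prop := 0 < c ∧ ∀ x, c * ‖σ.L x‖ ≤ 𝓣.margin / (2 * 𝓣.lu)

theorem exists_isFlat : ∃ c, σ.IsFlat c := by
  have hm := 𝓣.margin_pos
  have hlu := 𝓣.lu_pos
  refine ⟨𝓣.margin / (2 * 𝓣.lu) / (‖σ.L‖ + 1), by positivity, fun x => ?_⟩
  rw [div_mul_eq_mul_div, div_le_iff₀ (by positivity)]
  gcongr
  exact (σ.L.norm_coe_le_norm x).trans (le_add_of_nonneg_right zero_le_one)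

variable {σ} {c : ℝ} (hc : σ.IsFlat c) {x : Torus n} {v : E n} (hv0 : v ≠ 0)

include hc hv0

theorem IsFlat.norm_stable_lt (hv : v ∈ σ.bundle 0 x) :
    ‖𝓣.scaledCoords c (torusDeriv (𝓣.perm s) x v)‖ <
      (𝓣.lc - 3 * 𝓣.margin) * ‖𝓣.scaledCoords c v‖ := by
  have hDv : torusDeriv (𝓣.perm s) x v ∈ σ.bundle 0 (𝓣.perm s x) :=
    σ.map_bundle 0 x ▸ Submodule.mem_map_of_mem hv
  have hpos : 0 < ‖σ.chart x v‖ := by simpa using hv0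
  have hm := 𝓣.margin_pos
  have hm' := 𝓣.four_mul_margin_le_left
  have hls : 𝓣.ls ≤ 𝓣.lu := by
    linarith [𝓣.ls_lt_lc, 𝓣.lc_lt_one, 𝓣.one_lt_lc', 𝓣.lc'_lt_lu]
  have hls0 := 𝓣.ls_nonneg
  calc ‖𝓣.scaledCoords c (torusDeriv (𝓣.perm s) x v)‖
      ≤ (1 + 𝓣.margin / (2 * 𝓣.lu)) * (𝓣.ls * ‖σ.chart x v‖) := by
        refine (σ.norm_scaledCoords_le hc.1.le (by decide) hDv).trans ?_
        rw [chart_torusDeriv, 𝓣.blockDeriv_apply_of_ne s x (by decide) (σ.mem_bundle.1 hv)]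
        exact mul_le_mul (add_le_add_right (hc.2 _) 1) (𝓣.norm_diag_stable_le hv) (norm_nonneg _)
          (by have := 𝓣.lu_pos; positivity)
    _ = 𝓣.ls * (1 + 𝓣.margin / (2 * 𝓣.lu)) * ‖σ.chart x v‖ := by ring
    _ < (𝓣.lc - 3 * 𝓣.margin) * ‖σ.chart x v‖ := by
        gcongr
        linarith [𝓣.mul_one_add_le hls]
    _ ≤ (𝓣.lc - 3 * 𝓣.margin) * ‖𝓣.scaledCoords c v‖ := by
        gcongr
        · linarith
        · exact σ.norm_chart_le c (by decide) hv

theorem IsFlat.norm_center_mem_Ioo (hv : v ∈ σ.bundle 1 x) :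
    ‖𝓣.scaledCoords c (torusDeriv (𝓣.perm s) x v)‖ ∈
      Set.Ioo ((𝓣.lc - 2 * 𝓣.margin) * ‖𝓣.scaledCoords c v‖)
        ((𝓣.lc' + 2 * 𝓣.margin) * ‖𝓣.scaledCoords c v‖) := by
  have hDv : torusDeriv (𝓣.perm s) x v ∈ σ.bundle 1 (𝓣.perm s x) :=
    σ.map_bundle 1 x ▸ Submodule.mem_map_of_mem hv
  have hpos : 0 < 𝓣.margin * ‖σ.chart x v‖ := mul_pos 𝓣.margin_pos (by simpa using hv0)
  obtain ⟨z, hz⟩ := 𝓣.exists_coordDeriv_eq_mapDeriv s x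
  rw [σ.norm_scaledCoords_center hc.1.le hv, σ.norm_scaledCoords_center hc.1.le hDv,
    chart_torusDeriv, 𝓣.blockDeriv_apply_center s x (σ.mem_bundle.1 hv), hz, mul_left_comm,
    mul_left_comm _ c]
  constructor <;> refine mul_lt_mul_of_pos_left ?_ hc.1
  · linarith [𝓣.le_norm_mapDeriv s z (σ.mem_bundle.1 hv)]
  · linarith [𝓣.norm_mapDeriv_le s z (σ.mem_bundle.1 hv)]

theorem IsFlat.lt_norm_unstable (hv : v ∈ σ.bundle 2 x) :
    (𝓣.lc' + 3 * 𝓣.margin) * ‖𝓣.scaledCoords c v‖ <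
      ‖𝓣.scaledCoords c (torusDeriv (𝓣.perm s) x v)‖ := by
  have hDv : torusDeriv (𝓣.perm s) x v ∈ σ.bundle 2 (𝓣.perm s x) :=
    σ.map_bundle 2 x ▸ Submodule.mem_map_of_mem hv
  have hpos : 0 < ‖σ.chart x v‖ := by simpa using hv0
  have hm := 𝓣.margin_pos
  have hm' := 𝓣.four_mul_margin_le_right
  have hlc' := 𝓣.lc'_pos
  have hrate : 𝓣.lc' + 3 * 𝓣.margin ≤ 𝓣.lu := by linarith
  calc (𝓣.lc' + 3 * 𝓣.margin) * ‖𝓣.scaledCoords c v‖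
      ≤ (𝓣.lc' + 3 * 𝓣.margin) * ((1 + 𝓣.margin / (2 * 𝓣.lu)) * ‖σ.chart x v‖) := by
        gcongr
        refine (σ.norm_scaledCoords_le hc.1.le (by decide) hv).trans ?_
        gcongr
        exact hc.2 x
    _ = (𝓣.lc' + 3 * 𝓣.margin) * (1 + 𝓣.margin / (2 * 𝓣.lu)) * ‖σ.chart x v‖ := by ring
    _ < 𝓣.lu * ‖σ.chart x v‖ := by
        gcongr
        linarith [𝓣.mul_one_add_le hrate]
    _ ≤ ‖σ.chart (𝓣.perm s x) (torusDeriv (𝓣.perm s) x v)‖ := by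
        rw [chart_torusDeriv, 𝓣.blockDeriv_apply_of_ne s x (by decide) (σ.mem_bundle.1 hv)]
        exact 𝓣.le_norm_diag_unstable hv
    _ ≤ ‖𝓣.scaledCoords c (torusDeriv (𝓣.perm s) x v)‖ := σ.norm_chart_le c (by decide) hDv

omit hc hv0

theorem isPartiallyHyperbolic (σ : 𝓣.InvariantShear s) (hne : ∀ j, 𝓣.linearBundle j ≠ ⊥) :
    IsPartiallyHyperbolic (𝓣.perm s) (σ.bundle 0) (σ.bundle 1) (σ.bundle 2) where
  diffeo := 𝓣.isDiffeo_perm s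
  subbundle_ss := σ.isSubbundle_bundle 0
  subbundle_c := σ.isSubbundle_bundle 1
  subbundle_uu := σ.isSubbundle_bundle 2
  nontrivial x := ⟨σ.bundle_ne_bot (hne 0) x, σ.bundle_ne_bot (hne 1) x, σ.bundle_ne_bot (hne 2) x⟩
  splitting := σ.isInternal_bundle
  invariant_ss := σ.map_bundle 0
  invariant_c := σ.map_bundle 1
  invariant_uu := σ.map_bundle 2
  rates := by
    obtain ⟨c, hc⟩ := σ.exists_isFlat
    have hm := 𝓣.margin_pos
    refine ⟨constMetric _ (𝓣.injective_scaledCoords hc.1.ne'), 𝓣.lc - 3 * 𝓣.margin,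
      𝓣.lc - 2 * 𝓣.margin, 𝓣.lc' + 2 * 𝓣.margin, 𝓣.lc' + 3 * 𝓣.margin,
      by linarith [𝓣.lc_lt_one], by linarith [𝓣.one_lt_lc'], by linarith,
      by linarith [𝓣.lc_lt_one, 𝓣.one_lt_lc'], by linarith, fun x v hv0 => ?_⟩
    simp only [constMetric_norm]
    exact ⟨hc.norm_stable_lt hv0, hc.norm_center_mem_Ioo hv0, hc.lt_norm_unstable hv0⟩

end InvariantShear

theorem exists_memPH (hne : ∀ j, 𝓣.linearBundle j ≠ ⊥) :
    ∃ Ess Euu, MemPH A (𝓣.linearBundle 0) (𝓣.linearBundle 1) (𝓣.linearBundle 2) (𝓣.perm 1) Ess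
      (fun _ => 𝓣.linearBundle 1) Euu := by
  obtain ⟨σ⟩ := 𝓣.nonempty_invariantShear 1
  have hph := σ.isPartiallyHyperbolic hne
  rw [funext σ.bundle_one] at hph
  exact ⟨_, _, hph, 𝓣.isotopic_perm, σ.finrank_bundle 0, fun _ => rfl, σ.finrank_bundle 2⟩

theorem torusDeriv_perm_one_zero {v : E n} (hv : v ∈ 𝓣.linearBundle 1) :
    torusDeriv (𝓣.perm 1) 0 v = v := by
  have h := 𝓣.torusDeriv_perm_of_hasFDerivAt 1 (x := 0)
    (by rw [map_zero]; exact 𝓣.hasFDerivAt_map_zero _)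
  rw [← proj_zero, h]
  change 𝓣.T.symm (𝓣.mapDeriv 1 0 (𝓣.T v)) = v
  rw [ContinuousLinearEquiv.symm_apply_eq]
  ext i
  by_cases hi : 𝓣.τ i = 1
  · simp [Model.mapDeriv, radialDeriv, 𝓣.cutoff.apply_zero, 𝓣.defect_of_eq hi]
    ring
  · rw [𝓣.mapDeriv_apply_of_ne 1 0 _ hi, 𝓣.mem_linearBundle.1 hv i hi, mul_zero]

end ToralModel

/-! ### Expansivity -/

section Lyapunov

variable {q N : ℤ → ℝ} {θ : ℝ → ℝ} {C D : ℝ}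

theorem tendsto_zero_of_lyapunov {l : Filter ℤ} {a : ℝ} (hl : Filter.Tendsto (· + 1) l l)
    (hlim : Filter.Tendsto q l (nhds a)) (hN : ∀ k, 0 ≤ N k) (hq : ∀ k, |q k| ≤ C * N k ^ 2)
    (hθ : MonotoneOn θ (Set.Ici 0)) (hθpos : ∀ t, 0 < t → 0 < θ t)
    (hstep : ∀ k, q k + θ (N k) ≤ q (k + 1)) : Filter.Tendsto q l (nhds 0) := by
  have hincrement : Filter.Tendsto (fun k => q (k + 1) - q k) l (nhds 0) := by
    simpa using (hlim.comp hl).sub hlim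
  have hNlim : Filter.Tendsto N l (nhds 0) := by
    refine tendsto_order.2 ⟨fun b hb => .of_forall fun k => hb.trans_le (hN k), fun b hb => ?_⟩
    filter_upwards [hincrement.eventually_lt_const (hθpos b hb)] with k hk
    by_contra! hbN
    linarith [hθ hb.le (hN k) hbN, hstep k]
  exact squeeze_zero_norm hq (by simpa using (hNlim.pow 2).const_mul C)

/-- The increments of `q` tend to `0` at both ends, so `N` and hence `q` do; being monotone, `q`
vanishes. -/
theorem eq_zero_of_lyapunov (hN : ∀ k, 0 ≤ N k) (hND : ∀ k, N k ≤ D) (hC : 0 ≤ C)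
    (hq : ∀ k, |q k| ≤ C * N k ^ 2) (hθ : MonotoneOn θ (Set.Ici 0)) (hθ₀ : 0 ≤ θ 0)
    (hθpos : ∀ t, 0 < t → 0 < θ t) (hstep : ∀ k, q k + θ (N k) ≤ q (k + 1)) (k : ℤ) :
    N k = 0 := by
  have hmono : Monotone q := monotone_int_of_le_succ fun k =>
    (le_add_of_nonneg_right (hθ₀.trans (hθ Set.self_mem_Ici (hN k) (hN k)))).trans (hstep k)
  have hbound (k : ℤ) : |q k| ≤ C * D ^ 2 := (hq k).trans (by gcongr; exacts [hN k, hND k])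
  have habove : BddAbove (Set.range q) :=
    ⟨C * D ^ 2, Set.forall_mem_range.2 fun k => (abs_le.1 (hbound k)).2⟩
  have hbelow : BddBelow (Set.range q) :=
    ⟨-(C * D ^ 2), Set.forall_mem_range.2 fun k => (abs_le.1 (hbound k)).1⟩
  have htop := tendsto_zero_of_lyapunov (Filter.tendsto_atTop_add_const_right _ 1 Filter.tendsto_id)
    (tendsto_atTop_ciSup hmono habove) hN hq hθ hθpos hstep
  have hbot := tendsto_zero_of_lyapunov (Filter.tendsto_atBot_add_const_right _ 1 Filter.tendsto_id)
    (tendsto_atBot_ciInf hmono hbelow) hN hq hθ hθpos hstep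
  by_contra hne
  linarith [hθpos _ ((hN k).lt_of_ne' hne), hstep k, hmono.ge_of_tendsto htop (k + 1),
    hmono.le_of_tendsto hbot k]

theorem eq_zero_of_forall_eq_mul {a : ℤ → ℝ} {ν : ℝ} (hν : ν ^ 2 ≠ 1)
    (h : ∀ k, a (k + 1) = ν * a k) (hD : ∀ k, |a k| ≤ D) (k : ℤ) : a k = 0 := by
  have hν' := sub_ne_zero.2 hν
  refine abs_eq_zero.1 (eq_zero_of_lyapunov (q := fun k => a k ^ 2 / (ν ^ 2 - 1))
    (θ := fun t => t ^ 2) (C := |ν ^ 2 - 1|⁻¹) (fun k => abs_nonneg (a k)) hD (by positivity)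
    (fun k => ?_) (fun s hs t _ hst => pow_le_pow_left₀ hs hst 2) (by simp)
    (fun t ht => by positivity) (fun k => ?_) k)
  · rw [abs_div, abs_pow, div_eq_inv_mul]
  · refine le_of_eq ?_
    rw [h, sq_abs]
    field_simp
    ring

end Lyapunov

namespace SpectralData

variable {ι : Type*} (S : SpectralData ι)

theorem sq_ν_ne_one {i : ι} (hi : S.τ i ≠ 1) : S.ν i ^ 2 ≠ 1 := by
  have hlabel : ∀ j : Fin 3, j ≠ 1 → j = 0 ∨ j = 2 := by decide
  rw [Ne, ← sq_abs, pow_eq_one_iff_of_nonneg (abs_nonneg _) two_ne_zero]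
  rcases hlabel _ hi with hi | hi
  · exact ((S.stable i hi).trans_lt (S.ls_lt_lc.trans S.lc_lt_one)).ne
  · exact (S.one_lt_lc'.trans (S.lc'_lt_lu.trans_le (S.unstable i hi))).ne'

variable [Fintype ι]

/-- The Lyapunov function for the differences of two orbits along the centre; the hyperbolic terms
vanish, since there `defect` is `0`. -/
def centerForm (w : EuclideanSpace ℝ ι) : ℝ := ∑ i, w i ^ 2 / S.defect i

theorem abs_centerForm_le (w : EuclideanSpace ℝ ι) :
    |S.centerForm w| ≤ (∑ i, |S.defect i|⁻¹) * ‖w‖ ^ 2 := by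
  rw [centerForm, Finset.sum_mul]
  refine (Finset.abs_sum_le_sum_abs _ _).trans (Finset.sum_le_sum fun i _ => ?_)
  rw [abs_div, div_eq_inv_mul, abs_pow]
  gcongr
  exact PiLp.norm_apply_le w i

theorem centerForm_add_diag {w : EuclideanSpace ℝ ι} (hw : w ∈ S.block 1)
    (g : EuclideanSpace ℝ ι) :
    S.centerForm (w + diag S.defect g) =
      S.centerForm w + 2 * inner ℝ g w + ∑ i, S.defect i * g i ^ 2 := by
  rw [centerForm, centerForm, PiLp.inner_apply, Finset.mul_sum, ← Finset.sum_add_distrib,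
    ← Finset.sum_add_distrib]
  refine Finset.sum_congr rfl fun i _ => ?_
  simp only [PiLp.add_apply, diag_apply, RCLike.inner_apply, conj_trivial]
  by_cases hi : S.τ i = 1
  · have hdefect : S.defect i ≠ 0 := S.defect_of_eq hi ▸ sub_ne_zero.2 (S.center i hi).2
    field_simp
    ring
  · simp [hw i hi, S.defect_of_ne hi]

theorem neg_mul_norm_sq_le_sum_defect (g : EuclideanSpace ℝ ι) :
    -((1 - S.lc) * ‖g‖ ^ 2) ≤ ∑ i, S.defect i * g i ^ 2 := by
  rw [EuclideanSpace.norm_sq_eq, Finset.mul_sum, ← Finset.sum_neg_distrib]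
  refine Finset.sum_le_sum fun i _ => ?_
  have hdefect : -(1 - S.lc) ≤ S.defect i := by
    by_cases hi : S.τ i = 1
    · rw [S.defect_of_eq hi]
      linarith [(S.center i hi).1.1]
    · rw [S.defect_of_ne hi]
      linarith [S.lc_lt_one]
  rw [Real.norm_eq_abs, sq_abs, ← neg_mul]
  gcongr

end SpectralData

namespace Model

variable {ι : Type*} [Fintype ι] (𝓜 : Model ι)

/-- The gain of `centerForm` along the difference of two orbits at distance `t`. -/
def gain (t : ℝ) : ℝ := 𝓜.lc * (1 - 𝓜.ψ ((t / 2) ^ 2)) * t ^ 2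

theorem gain_zero : 𝓜.gain 0 = 0 := by simp [gain]

theorem gain_pos {t : ℝ} (ht : 0 < t) : 0 < 𝓜.gain t := by
  have hlc := 𝓜.lc_pos
  have hψ : 0 < 1 - 𝓜.ψ ((t / 2) ^ 2) := sub_pos.2 (𝓜.cutoff.lt_one _ (by positivity))
  unfold gain
  positivity

theorem monotoneOn_gain : MonotoneOn 𝓜.gain (Set.Ici 0) := by
  intro s (hs : 0 ≤ s) t _ hst
  have hlc := 𝓜.lc_pos
  have hψ : 0 ≤ 1 - 𝓜.ψ ((t / 2) ^ 2) := sub_nonneg.2 (𝓜.cutoff.le_one _)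
  have hanti : 𝓜.ψ ((t / 2) ^ 2) ≤ 𝓜.ψ ((s / 2) ^ 2) :=
    𝓜.cutoff.antitone_sq (by positivity) (by gcongr)
  unfold gain
  gcongr

variable {w : EuclideanSpace ℝ ι}

theorem exists_vectorField_eq (x : EuclideanSpace ℝ ι) (hw : ‖w‖ ≤ 𝓜.r) :
    ∃ z, 𝓜.vectorField x = radial 𝓜.ψ z ∧ 𝓜.vectorField (x - w) = radial 𝓜.ψ (z - w) := by
  obtain ⟨γ, -, h⟩ := exists_periodize_eq 𝓜.separated 𝓜.radial_eq_zero_of_le x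
  refine ⟨x - γ, h x (by simpa using 𝓜.r_pos.le), ?_⟩
  rw [sub_right_comm]
  exact h (x - w) (by simpa using hw)

theorem map_sub_map (s : ℝ) (x y : EuclideanSpace ℝ ι) :
    𝓜.map s x - 𝓜.map s y =
      diag 𝓜.ν (x - y) - s • diag 𝓜.defect (𝓜.vectorField x - 𝓜.vectorField y) := by
  simp only [map, map_sub, smul_sub]
  abel

theorem norm_map_one_sub_le (x : EuclideanSpace ℝ ι) (hw : ‖w‖ ≤ 𝓜.r) :
    ‖𝓜.map 1 x - 𝓜.map 1 (x - w)‖ ≤ (‖diag 𝓜.ν‖ + 3 * 𝓜.lc') * ‖w‖ := by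
  obtain ⟨z, hx, hxw⟩ := 𝓜.exists_vectorField_eq x hw
  have hlc' := 𝓜.lc'_pos
  have hlip := norm_radial_sub_le 𝓜.cutoff 𝓜.two_mul_slowness_le_one z (z - w)
  rw [sub_sub_cancel] at hlip
  rw [map_sub_map, sub_sub_cancel, one_smul, hx, hxw]
  calc ‖diag 𝓜.ν w - diag 𝓜.defect (radial 𝓜.ψ z - radial 𝓜.ψ (z - w))‖
      ≤ ‖diag 𝓜.ν w‖ + ‖diag 𝓜.defect (radial 𝓜.ψ z - radial 𝓜.ψ (z - w))‖ := norm_sub_le _ _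
    _ ≤ ‖diag 𝓜.ν‖ * ‖w‖ + 𝓜.lc' * (3 * ‖w‖) := by
        gcongr
        · exact ContinuousLinearMap.le_opNorm _ _
        · refine (norm_diag_le hlc'.le fun i _ => 𝓜.abs_defect_le i).trans ?_
          gcongr
    _ = (‖diag 𝓜.ν‖ + 3 * 𝓜.lc') * ‖w‖ := by ring

theorem le_centerForm_map_sub (x : EuclideanSpace ℝ ι) (hw : ‖w‖ ≤ 𝓜.r) (hc : w ∈ 𝓜.block 1) :
    𝓜.centerForm w + 𝓜.gain ‖w‖ ≤ 𝓜.centerForm (𝓜.map 1 x - 𝓜.map 1 (x - w)) := by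
  obtain ⟨z, hx, hxw⟩ := 𝓜.exists_vectorField_eq x hw
  set g := w - (radial 𝓜.ψ z - radial 𝓜.ψ (z - w)) with hg
  have hmap : 𝓜.map 1 x - 𝓜.map 1 (x - w) = w + diag 𝓜.defect g := by
    rw [map_sub_map, sub_sub_cancel, one_smul, hx, hxw, hg, map_sub _ w, ← add_sub_assoc]
    congr 1
    ext i
    by_cases hi : 𝓜.τ i = 1
    · simp [𝓜.defect_of_eq hi]
      ring
    · simp [𝓜.defect_of_ne hi, hc i hi]
  have hupper := norm_sq_complement_sub_le 𝓜.cutoff 𝓜.two_mul_slowness_le_one z (z - w)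
  have hlower := le_inner_complement_sub 𝓜.cutoff z (z - w)
  rw [sub_sub_cancel, ← hg] at hupper hlower
  have hlc := 𝓜.lc_pos
  calc 𝓜.centerForm w + 𝓜.gain ‖w‖
      = 𝓜.centerForm w + 2 * 𝓜.lc * ((1 - 𝓜.ψ ((‖w‖ / 2) ^ 2)) / 2 * ‖w‖ ^ 2) := by
        rw [gain]
        ring
    _ ≤ 𝓜.centerForm w + 2 * 𝓜.lc * inner ℝ g w := by gcongr
    _ = 𝓜.centerForm w + 2 * inner ℝ g w - (1 - 𝓜.lc) * (2 * inner ℝ g w) := by ring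
    _ ≤ 𝓜.centerForm w + 2 * inner ℝ g w - (1 - 𝓜.lc) * ‖g‖ ^ 2 := by
        gcongr
        linarith [𝓜.lc_lt_one]
    _ ≤ 𝓜.centerForm w + 2 * inner ℝ g w + ∑ i, 𝓜.defect i * g i ^ 2 := by
        rw [sub_eq_add_neg]
        gcongr
        exact 𝓜.neg_mul_norm_sq_le_sum_defect g
    _ = 𝓜.centerForm (𝓜.map 1 x - 𝓜.map 1 (x - w)) := by
        rw [hmap, 𝓜.centerForm_add_diag hc]

theorem eq_zero_of_orbit_sub {X W : ℤ → EuclideanSpace ℝ ι} (hW : ∀ k, ‖W k‖ ≤ 𝓜.r)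
    (h : ∀ k, W (k + 1) = 𝓜.map 1 (X k) - 𝓜.map 1 (X k - W k)) (k : ℤ) : W k = 0 := by
  have hcentral (k : ℤ) : W k ∈ 𝓜.block 1 := fun i hi => by
    refine eq_zero_of_forall_eq_mul (a := fun k => W k i) (𝓜.sq_ν_ne_one hi) (fun k => ?_)
      (fun k => (PiLp.norm_apply_le (W k) i).trans (hW k)) k
    rw [h, PiLp.sub_apply, 𝓜.map_apply_of_ne 1 _ hi, 𝓜.map_apply_of_ne 1 _ hi, ← mul_sub,
      PiLp.sub_apply, sub_sub_cancel]
  refine norm_eq_zero.1 (eq_zero_of_lyapunov (q := fun k => 𝓜.centerForm (W k))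
    (fun k => norm_nonneg (W k)) hW (Finset.sum_nonneg fun i _ => by positivity)
    (fun k => 𝓜.abs_centerForm_le (W k)) 𝓜.monotoneOn_gain 𝓜.gain_zero.ge (fun t => 𝓜.gain_pos)
    (fun k => ?_) k)
  rw [h]
  exact 𝓜.le_centerForm_map_sub (X k) (hW k) (hcentral k)

/-- A distance below which the images under `map 1` of two points are at distance less than `r`. -/
def orbitRadius : ℝ := 𝓜.r / (‖diag 𝓜.ν‖ + 3 * 𝓜.lc')

theorem orbitRadius_pos : 0 < 𝓜.orbitRadius := by
  have hlc' := 𝓜.lc'_pos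
  have hr := 𝓜.r_pos
  unfold orbitRadius
  positivity

theorem orbitRadius_le : 𝓜.orbitRadius ≤ 𝓜.r :=
  div_le_self 𝓜.r_pos.le (by linarith [𝓜.one_lt_lc', norm_nonneg (diag 𝓜.ν)])

theorem norm_map_one_sub_le_of_le (x : EuclideanSpace ℝ ι) (hw : ‖w‖ ≤ 𝓜.orbitRadius) :
    ‖𝓜.map 1 x - 𝓜.map 1 (x - w)‖ ≤ 𝓜.r := by
  have hlc' := 𝓜.lc'_pos
  refine (𝓜.norm_map_one_sub_le x (hw.trans 𝓜.orbitRadius_le)).trans ?_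
  rwa [← le_div_iff₀' (by positivity)]

end Model

theorem exists_mem_proj_eq_sub {n : ℕ} {U : Set (E n)} (hU : U ∈ nhds 0) :
    ∃ δ > 0, ∀ x y : Torus n, dist x y ≤ δ → ∃ w ∈ U, proj w = x - y := by
  have hmem : proj '' U ∈ nhds (0 : Torus n) :=
    proj_zero (n := n) ▸ isOpenQuotientMap_proj.isOpenMap.image_mem_nhds hU
  obtain ⟨δ, hδ, hball⟩ := Metric.nhds_basis_closedBall.mem_iff.1 hmem
  exact ⟨δ, hδ, fun x y hxy => hball (by rwa [mem_closedBall_zero_iff, ← dist_eq_norm])⟩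

namespace ToralModel

variable {n : ℕ} {A : Matrix.SpecialLinearGroup (Fin n) ℤ} {ι : Type*} [Fintype ι]
  (𝓣 : ToralModel A ι)

theorem T_eq_map_one_sub {u w w' : E n} (hw : ‖𝓣.T w‖ ≤ 𝓣.orbitRadius)
    (hw' : ‖𝓣.T w'‖ ≤ 𝓣.orbitRadius)
    (h : proj w' = 𝓣.perm 1 (proj u) - 𝓣.perm 1 (proj u - proj w)) :
    𝓣.T w' = 𝓣.map 1 (𝓣.T u) - 𝓣.map 1 (𝓣.T u - 𝓣.T w) := by
  set d := 𝓣.map 1 (𝓣.T u) - 𝓣.map 1 (𝓣.T u - 𝓣.T w) with hd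
  have hlift : 𝓣.T.symm d = 𝓣.lift 1 u - 𝓣.lift 1 (u - w) := by
    rw [hd, map_sub, lift_apply, lift_apply, map_sub 𝓣.T]
    rfl
  have hmem : 𝓣.T w' - d ∈ 𝓣.Γ := by
    rw [𝓣.mem_Γ, map_sub, ContinuousLinearEquiv.symm_apply_apply, hlift, proj_sub, proj_sub, h,
      ← perm_proj, ← perm_proj, proj_sub, sub_self]
  by_contra hne
  linarith [𝓣.separated _ hmem (sub_ne_zero.2 hne), norm_sub_le (𝓣.T w') d,
    𝓣.norm_map_one_sub_le_of_le (𝓣.T u) hw, 𝓣.orbitRadius_le, 𝓣.r_pos]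

theorem isExpansive_perm : IsExpansive (𝓣.perm 1) := by
  have hU : {w : E n | ‖𝓣.T w‖ ≤ 𝓣.orbitRadius} ∈ nhds 0 :=
    (𝓣.T.continuous.norm.tendsto' 0 0 (by rw [map_zero, norm_zero])).eventually_le_const
      𝓣.orbitRadius_pos
  obtain ⟨δ, hδ, hclose⟩ := exists_mem_proj_eq_sub hU
  refine ⟨δ, hδ, fun x y hxy => ?_⟩
  choose w hw hproj using fun k : ℤ => hclose _ _ (hxy k)
  choose u hu using fun k : ℤ => proj_surjective ((𝓣.perm 1 ^ k) x)
  have hsucc (k : ℤ) (z : Torus n) : (𝓣.perm 1 ^ (k + 1)) z = 𝓣.perm 1 ((𝓣.perm 1 ^ k) z) := by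
    rw [add_comm, zpow_one_add, Equiv.Perm.mul_apply]
  have hstep (k : ℤ) := 𝓣.T_eq_map_one_sub (u := u k) (hw k) (hw (k + 1))
    (by rw [hu, hproj, hproj, sub_sub_cancel, hsucc, hsucc])
  have hzero : 𝓣.T (w 0) = 0 := 𝓣.eq_zero_of_orbit_sub (X := fun k => 𝓣.T (u k))
    (W := fun k => 𝓣.T (w k)) (fun k => (hw k).trans 𝓣.orbitRadius_le) hstep 0
  have hxy₀ := hproj 0
  rw [(map_eq_zero_iff _ 𝓣.T.injective).1 hzero, proj_zero] at hxy₀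
  simpa [sub_eq_zero] using hxy₀.symm

end ToralModel

/-! ### Existence of the perturbation -/

theorem repr_apply_of_eigenbasis {R M ι : Type*} [CommSemiring R] [AddCommMonoid M] [Module R M]
    {b : Module.Basis ι R M} {f : M →ₗ[R] M} {ν : ι → R} (hb : ∀ i, f (b i) = ν i • b i) (x : M)
    (i : ι) : b.repr (f x) i = ν i * b.repr x i := by
  classical
  have h : b.coord i ∘ₗ f = ν i • b.coord i := b.ext fun j => by
    rcases eq_or_ne j i with rfl | hij <;> simp [*]
  exact LinearMap.congr_fun h x

theorem exists_lattice_radius {n : ℕ} {X : Type*} [NormedAddCommGroup X] [NormedSpace ℝ X]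
    (e : X ≃L[ℝ] E n) {ε : ℝ} (hε : 0 < ε) : ∃ r > 0, (∀ y, ‖y‖ < r → ‖e y‖ < ε) ∧
      ∀ y, proj (e y) = 0 → y ≠ 0 → 4 * r ≤ ‖y‖ := by
  have htendsto : Filter.Tendsto (fun y => ‖e y‖) (nhds 0) (nhds 0) :=
    e.continuous.norm.tendsto' 0 0 (by rw [map_zero, norm_zero])
  obtain ⟨ρ, hρ, hball⟩ := Metric.eventually_nhds_iff.1
    (htendsto.eventually_lt_const (lt_min hε one_pos))
  simp only [dist_zero_right] at hball
  refine ⟨ρ / 4, by positivity, fun y hy => ?_, fun y hproj hne => ?_⟩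
  · exact (hball (by linarith)).trans_le (min_le_left _ _)
  · by_contra! hlt
    exact ((one_le_norm_of_proj_eq_zero hproj (by simpa using hne)).trans_lt
      (hball (by linarith))).not_ge (min_le_right _ _)

/-- The coordinates in the basis `b`, with the Euclidean norm on the coordinate space. -/
def coordinates {n : ℕ} {ι : Type*} [Fintype ι] (b : Module.Basis ι ℝ (E n)) :
    E n ≃L[ℝ] EuclideanSpace ℝ ι :=
  (b.equivFun.trans (WithLp.linearEquiv 2 ℝ (ι → ℝ)).symm).toContinuousLinearEquiv

theorem coordinates_apply {n : ℕ} {ι : Type*} [Fintype ι] (b : Module.Basis ι ℝ (E n)) (v : E n)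
    (i : ι) : coordinates b v i = b.repr v i := rfl

namespace SpectralData

section LabelSpan

variable {ι V : Type*} [AddCommGroup V] [Module ℝ V] (S : SpectralData ι)
  (b : Module.Basis ι ℝ V) (j : Fin 3)

/-- The sum of the eigenlines, spanned by vectors of the basis `b`, which carry the label `j`. -/
def labelSpan : Submodule ℝ V := Submodule.span ℝ (b '' {i | S.τ i = j})

theorem labelSpan_ne_bot (hτ : Function.Surjective S.τ) : S.labelSpan b j ≠ ⊥ := by
  obtain ⟨i, hi⟩ := hτ j
  exact (Submodule.ne_bot_iff _).2 ⟨b i, Submodule.subset_span ⟨i, hi, rfl⟩, b.ne_zero i⟩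

end LabelSpan

variable {n : ℕ} {A : Matrix.SpecialLinearGroup (Fin n) ℤ} {ι : Type*} [Fintype ι]
  (S : SpectralData ι)

theorem exists_toralModel (T : E n ≃L[ℝ] EuclideanSpace ℝ ι)
    (hT : ∀ x, T (linMap A x) = diag S.ν (T x)) {ε : ℝ} (hε : 0 < ε) :
    ∃ 𝓣 : ToralModel A ι, 𝓣.toSpectralData = S ∧ 𝓣.T = T ∧
      ∀ y, ‖y‖ < 𝓣.r → ‖𝓣.T.symm y‖ < ε := by
  obtain ⟨r, hr, hsmall, hseparated⟩ := exists_lattice_radius T.symm hε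
  obtain ⟨ψ, hψ⟩ :=
    exists_isSlowCutoff (div_pos S.margin_pos (mul_pos two_pos S.lc'_pos)) (pow_pos hr 2)
  exact ⟨{ S with
    Γ := ((AddMonoidHom.mk' proj proj_add).comp (T.symm : EuclideanSpace ℝ ι →+ E n)).ker
    r := r
    ψ := ψ
    r_pos := hr
    separated := hseparated
    cutoff := hψ
    T := T
    T_linMap := hT
    mem_Γ := fun _ => Iff.rfl }, rfl, rfl, hsmall⟩

theorem mem_labelSpan {b : Module.Basis ι ℝ (E n)} {j : Fin 3} {v : E n} :
    v ∈ S.labelSpan b j ↔ coordinates b v ∈ S.block j := by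
  rw [labelSpan, Module.Basis.mem_span_image]
  refine forall_congr' fun i => ?_
  rw [Finset.mem_coe, Finsupp.mem_support_iff, ne_eq, not_imp_comm, coordinates_apply,
    Set.mem_ofPred_eq]

theorem coordinates_linMap {b : Module.Basis ι ℝ (E n)} (hb : ∀ i, linMap A (b i) = S.ν i • b i)
    (x : E n) : coordinates b (linMap A x) = diag S.ν (coordinates b x) :=
  PiLp.ext fun i => by
    rw [diag_apply, coordinates_apply, coordinates_apply, repr_apply_of_eigenbasis hb]

end SpectralData

/-! ### Symmetric partially hyperbolic automorphisms -/

theorem isSymmetric_linMap {n : ℕ} {A : Matrix.SpecialLinearGroup (Fin n) ℤ} (hA : A.1.IsSymm) :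
    (linMap A).IsSymmetric := by
  rw [linMap, Matrix.isSymmetric_toEuclideanLin_iff, Matrix.IsHermitian,
    Matrix.conjTranspose_eq_transpose_of_trivial]
  exact hA.map _

theorem exists_eigenbasis_of_isSymmetric {𝕜 F : Type*} [RCLike 𝕜] [NormedAddCommGroup F]
    [InnerProductSpace 𝕜 F] {f : F →ₗ[𝕜] F} (hf : f.IsSymmetric) (U : Submodule 𝕜 F)
    [FiniteDimensional 𝕜 U] (hU : ∀ v ∈ U, f v ∈ U) :
    ∃ (m : ℕ) (b : Module.Basis (Fin m) 𝕜 U) (μ : Fin m → ℝ),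
      ∀ i, f (b i) = (μ i : 𝕜) • (b i : F) := by
  have h := hf.restrict_invariant hU
  refine ⟨_, (h.eigenvectorBasis rfl).toBasis, h.eigenvalues rfl, fun i => ?_⟩
  rw [OrthonormalBasis.coe_toBasis]
  exact congrArg Subtype.val (h.apply_eigenvectorBasis rfl i)

theorem span_collectedBasis_image {R M κ : Type*} [Ring R] [AddCommGroup M] [Module R M]
    [DecidableEq κ] {V : κ → Submodule R M} (hV : DirectSum.IsInternal V) {β : κ → Type*}
    (c : ∀ j, Module.Basis (β j) R (V j)) (j : κ) :
    Submodule.span R (hV.collectedBasis c '' {a | a.1 = j}) = V j := by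
  apply le_antisymm
  · rw [Submodule.span_le]
    rintro _ ⟨⟨j, i⟩, rfl, rfl⟩
    exact hV.collectedBasis_mem c ⟨j, i⟩
  · rw [← Submodule.map_subtype_top (V j), ← (c j).span_eq, Submodule.map_span, Submodule.span_le]
    rintro _ ⟨_, ⟨i, rfl⟩, rfl⟩
    exact Submodule.subset_span ⟨⟨j, i⟩, rfl, congrFun (hV.collectedBasis_coe c) ⟨j, i⟩⟩

theorem RiemMetric.norm_smul {n : ℕ} (g : RiemMetric n) (x : Torus n) (c : ℝ) (v : E n) :
    g.norm x (c • v) = |c| * g.norm x v := by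
  simp only [RiemMetric.norm, map_smul, FunLike.coe_smul, Pi.smul_apply, smul_eq_mul]
  rw [← mul_assoc, ← sq, Real.sqrt_mul (sq_nonneg c), Real.sqrt_sq_eq_abs]

theorem RiemMetric.norm_pos {n : ℕ} (g : RiemMetric n) (x : Torus n) {v : E n} (hv : v ≠ 0) :
    0 < g.norm x v := Real.sqrt_pos.2 (g.pos x v hv)

theorem torusDeriv_toralAut {n : ℕ} (A : Matrix.SpecialLinearGroup (Fin n) ℤ) (x : Torus n) :
    torusDeriv (toralAut A) x = LinearMap.toContinuousLinearMap (linMap A) := by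
  obtain ⟨x, rfl⟩ := proj_surjective x
  rw [torusDeriv_proj ⟨(LinearMap.toContinuousLinearMap (linMap A)).contDiff, proj_linMap A⟩]
  exact (LinearMap.toContinuousLinearMap (linMap A)).hasFDerivAt.fderiv

namespace IsPartiallyHyperbolic

variable {n : ℕ} {A : Matrix.SpecialLinearGroup (Fin n) ℤ} {Sss Sc Suu : Submodule ℝ (E n)}

theorem linMap_mem_of_map_torusDeriv {U : Submodule ℝ (E n)}
    (hU : U.map (torusDeriv (toralAut A) 0 : E n →ₗ[ℝ] E n) = U) {v : E n} (hv : v ∈ U) :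
    linMap A v ∈ U := by
  rw [← hU, torusDeriv_toralAut]
  exact ⟨v, hv, rfl⟩

/-- At the fixed point `0` the norms before and after applying the derivative are the same, so an
eigenvector is multiplied by the modulus of its eigenvalue. -/
theorem exists_eigenvalue_rates (hPH : IsPartiallyHyperbolic (toralAut A) (fun _ => Sss)
      (fun _ => Sc) (fun _ => Suu)) :
    ∃ ls lc lc' lu : ℝ, 0 ≤ ls ∧ ls < 1 ∧ 1 < lu ∧ ls < lc ∧ lc' < lu ∧
      ∀ (v : E n) (μ : ℝ), v ≠ 0 → linMap A v = μ • v →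
        (v ∈ Sss → |μ| < ls) ∧ (v ∈ Sc → |μ| ∈ Set.Ioo lc lc') ∧ (v ∈ Suu → lu < |μ|) := by
  obtain ⟨g, ls, lc, lc', lu, hls, hlu, hlc, -, hlc', hrates⟩ := hPH.rates
  have hrate := hrates 0
  simp only [torusDeriv_toralAut, toralAut_zero, LinearMap.coe_toContinuousLinearMap'] at hrate
  refine ⟨ls, lc, lc', lu, ?_, hls, hlu, hlc, hlc', fun v μ hv hμ => ?_⟩
  · obtain ⟨v, hvS, hv⟩ := Submodule.exists_mem_ne_zero_of_ne_bot (hPH.nontrivial 0).1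
    exact (pos_of_mul_pos_left ((Real.sqrt_nonneg _).trans_lt ((hrate v hv).1 hvS))
      (g.norm_pos 0 hv).le).le
  · have hpos := g.norm_pos 0 hv
    simpa only [hμ, g.norm_smul, Set.mem_Ioo, mul_lt_mul_iff_left₀ hpos] using hrate v hv

theorem exists_spectralData (hPH : IsPartiallyHyperbolic (toralAut A) (fun _ => Sss)
      (fun _ => Sc) (fun _ => Suu)) {β : Fin 3 → Type*}
    (c : ∀ j, Module.Basis (β j) ℝ (![Sss, Sc, Suu] j)) (μ : ∀ j, β j → ℝ)
    (hc : ∀ j i, linMap A (c j i) = μ j i • (c j i : E n)) (hμ : ∀ i, 0 < μ 1 i ∧ μ 1 i ≠ 1) :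
    ∃ S : SpectralData (Σ j, β j), S.ν = (fun a => μ a.1 a.2) ∧ S.τ = Sigma.fst := by
  obtain ⟨ls, lc, lc', lu, hls, hls₁, hlu₁, hlc, hlc', hrates⟩ := hPH.exists_eigenvalue_rates
  have hne (j : Fin 3) (i : β j) : (c j i : E n) ≠ 0 := by simpa using (c j).ne_zero i
  have hrate (j : Fin 3) (i : β j) := hrates (c j i) (μ j i) (hne j i) (hc j i)
  have hmin : ls < min lc 1 := lt_min hlc hls₁
  have hmax : max lc' 1 < lu := max_lt hlc' hlu₁
  refine ⟨{
    ν := fun a => μ a.1 a.2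
    τ := Sigma.fst
    ls := ls
    lc := (ls + min lc 1) / 2
    lc' := (max lc' 1 + lu) / 2
    lu := lu
    ls_nonneg := hls
    ls_lt_lc := by linarith
    lc_lt_one := by linarith [min_le_right lc 1]
    one_lt_lc' := by linarith [le_max_right lc' 1]
    lc'_lt_lu := by linarith
    ν_ne_zero := fun a h0 => hne a.1 a.2 (linMap_injective A (by
      rw [hc, h0, zero_smul, map_zero]))
    stable := ?_
    center := ?_
    unstable := ?_ }, rfl, rfl⟩
  · rintro ⟨j, i⟩ (rfl : j = 0)
    exact ((hrate 0 i).1 (c 0 i).2).le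
  · rintro ⟨j, i⟩ (rfl : j = 1)
    have h := (hrate 1 i).2.1 (c 1 i).2
    rw [abs_of_pos (hμ i).1] at h
    exact ⟨⟨by linarith [h.1, min_le_left lc 1], by linarith [h.2, le_max_left lc' 1]⟩, (hμ i).2⟩
  · rintro ⟨j, i⟩ (rfl : j = 2)
    exact ((hrate 2 i).2.2 (c 2 i).2).le

theorem exists_spectralData_of_isSymm {κ : Type} (hA : A.1.IsSymm)
    (hPH : IsPartiallyHyperbolic (toralAut A) (fun _ => Sss) (fun _ => Sc) (fun _ => Suu))
    (b : Module.Basis κ ℝ Sc) {lam : κ → ℝ} (hlam : ∀ i, 0 < lam i ∧ lam i ≠ 1)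
    (hb : ∀ i, linMap A (b i) = lam i • (b i : E n)) :
    ∃ (ι : Type) (S : SpectralData ι) (c : Module.Basis ι ℝ (E n)), Function.Surjective S.τ ∧
      (∀ i, linMap A (c i) = S.ν i • c i) ∧
      S.labelSpan c 0 = Sss ∧ S.labelSpan c 1 = Sc ∧ S.labelSpan c 2 = Suu := by
  obtain ⟨m₀, b₀, μ₀, h₀⟩ := exists_eigenbasis_of_isSymmetric (isSymmetric_linMap hA) Sss
    fun v => linMap_mem_of_map_torusDeriv (hPH.invariant_ss 0)
  obtain ⟨m₂, b₂, μ₂, h₂⟩ := exists_eigenbasis_of_isSymmetric (isSymmetric_linMap hA) Suu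
    fun v => linMap_mem_of_map_torusDeriv (hPH.invariant_uu 0)
  let β : Fin 3 → Type := ![Fin m₀, κ, Fin m₂]
  let c : ∀ j, Module.Basis (β j) ℝ (![Sss, Sc, Suu] j) :=
    Fin.cons b₀ (Fin.cons b (Fin.cons b₂ finZeroElim))
  let μ : ∀ j, β j → ℝ := Fin.cons μ₀ (Fin.cons lam (Fin.cons μ₂ finZeroElim))
  have hc (j : Fin 3) : ∀ i, linMap A (c j i) = μ j i • (c j i : E n) := by
    fin_cases j
    exacts [h₀, hb, h₂]
  obtain ⟨S, hν, hτ⟩ := hPH.exists_spectralData c μ hc hlam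
  have hV := hPH.splitting 0
  have hspan (j : Fin 3) : S.labelSpan (hV.collectedBasis c) j = ![Sss, Sc, Suu] j := by
    rw [SpectralData.labelSpan, hτ, span_collectedBasis_image]
  have hnontrivial (j : Fin 3) : Nontrivial (![Sss, Sc, Suu] j) := by
    rw [Submodule.nontrivial_iff_ne_bot]
    obtain ⟨hss, hc, huu⟩ := hPH.nontrivial 0
    fin_cases j
    exacts [hss, hc, huu]
  refine ⟨_, S, hV.collectedBasis c, fun j => ?_, fun a => ?_, hspan 0, hspan 1, hspan 2⟩
  · obtain ⟨i⟩ := (c j).index_nonempty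
    exact ⟨⟨j, i⟩, by rw [hτ]⟩
  · rw [hV.collectedBasis_coe, hc, hν]

end IsPartiallyHyperbolic

/-! ### Automorphisms with simple spectrum -/

theorem exists_eigenbasis_of_injective {K V ι : Type*} [Field K] [AddCommGroup V] [Module K V]
    [FiniteDimensional K V] [Fintype ι] {f : V →ₗ[K] V} {ν : ι → K} (hν : Function.Injective ν)
    (hf : ∀ i, Module.End.HasEigenvalue f (ν i)) (hcard : Fintype.card ι = Module.finrank K V) :
    ∃ b : Module.Basis ι K V, ∀ i, f (b i) = ν i • b i := by
  choose v hv using fun i => (hf i).exists_hasEigenvector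
  have hli := Module.End.eigenvectors_linearIndependent' f ν hν v hv
  have hspan := hli.span_eq_top_of_card_eq_finrank' hcard
  exact ⟨.mk hli hspan.ge, fun i => by rw [Module.Basis.mk_apply, (hv i).apply_eq_smul]⟩

theorem eigenspace_eq_span_image {R M ι : Type*} [CommRing R] [IsDomain R] [AddCommGroup M]
    [Module R M] {b : Module.Basis ι R M} {f : M →ₗ[R] M} {ν : ι → R}
    (hb : ∀ i, f (b i) = ν i • b i) (μ : R) :
    Module.End.eigenspace f μ = Submodule.span R (b '' {i | ν i = μ}) := by
  ext x
  rw [Module.End.mem_eigenspace_iff, b.mem_span_image, ← b.repr.injective.eq_iff, Finsupp.ext_iff]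
  refine forall_congr' fun i => ?_
  rw [repr_apply_of_eigenbasis hb, map_smul, Finsupp.smul_apply, smul_eq_mul, mul_eq_mul_right_iff,
    Finset.mem_coe, Finsupp.mem_support_iff, ne_eq, or_comm, or_iff_not_imp_left, Set.mem_ofPred_eq]

theorem SpectralData.finrank_labelSpan {ι V : Type*} [Fintype ι] [AddCommGroup V] [Module ℝ V]
    (S : SpectralData ι) (b : Module.Basis ι ℝ V) (j : Fin 3) :
    Module.finrank ℝ (S.labelSpan b j) = Fintype.card {i // S.τ i = j} := by
  rw [labelSpan, Set.image_eq_range]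
  exact finrank_span_eq_card (b.linearIndependent.comp _ Subtype.val_injective)

/-- Four simple eigenvalues, the inner two of which form the central spectrum. -/
def SpectralData.ofFour {lss l m muu : ℝ} (h0 : 0 < lss) (h1 : lss < l) (h2 : l < 1) (h3 : 1 < m)
    (h4 : m < muu) : SpectralData (Fin 4) where
  ν := ![lss, l, m, muu]
  τ := ![0, 1, 1, 2]
  ls := lss
  lc := l
  lc' := m
  lu := muu
  ls_nonneg := h0.le
  ls_lt_lc := h1
  lc_lt_one := h2
  one_lt_lc' := h3
  lc'_lt_lu := h4
  ν_ne_zero i := by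
    fin_cases i
    exacts [h0.ne', (h0.trans h1).ne', (one_pos.trans h3).ne', (one_pos.trans (h3.trans h4)).ne']
  stable i hi := by
    fin_cases i
    · exact (abs_of_pos h0).le
    all_goals exact absurd hi (by decide)
  center i hi := by
    fin_cases i
    · exact absurd hi (by decide)
    · exact ⟨⟨le_rfl, (h2.trans h3).le⟩, h2.ne⟩
    · exact ⟨⟨(h2.trans h3).le, le_rfl⟩, h3.ne'⟩
    · exact absurd hi (by decide)
  unstable i hi := by
    fin_cases i
    iterate 3 exact absurd hi (by decide)
    exact le_abs_self muu

theorem exists_spectralData_of_hasEigenvalue {A : Matrix.SpecialLinearGroup (Fin 4) ℤ}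
    {lss l m muu : ℝ} (h0 : 0 < lss) (h1 : lss < l) (h2 : l < 1) (h3 : 1 < m) (h4 : m < muu)
    (hss : Module.End.HasEigenvalue (linMap A) lss) (hl : Module.End.HasEigenvalue (linMap A) l)
    (hm : Module.End.HasEigenvalue (linMap A) m)
    (huu : Module.End.HasEigenvalue (linMap A) muu) :
    ∃ (S : SpectralData (Fin 4)) (b : Module.Basis (Fin 4) ℝ (E 4)), Function.Surjective S.τ ∧
      (∀ i, linMap A (b i) = S.ν i • b i) ∧
      S.labelSpan b 0 = Module.End.eigenspace (linMap A) lss ∧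
      S.labelSpan b 1 =
        Module.End.eigenspace (linMap A) l ⊔ Module.End.eigenspace (linMap A) m ∧
      S.labelSpan b 2 = Module.End.eigenspace (linMap A) muu ∧
      Module.finrank ℝ (S.labelSpan b 1) = 2 := by
  let S := SpectralData.ofFour h0 h1 h2 h3 h4
  have hsurj : Function.Surjective (![0, 1, 1, 2] : Fin 4 → Fin 3) := by decide
  have hν : Function.Injective S.ν := by
    refine (Fin.strictMono_iff_lt_succ.2 fun i => ?_).injective
    fin_cases i
    exacts [h1, h2.trans h3, h4]
  obtain ⟨b, hb⟩ := exists_eigenbasis_of_injective hν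
    (fun i => by fin_cases i; exacts [hss, hl, hm, huu]) finrank_euclideanSpace.symm
  have heig (i : Fin 4) :
      Module.End.eigenspace (linMap A) (S.ν i) = Submodule.span ℝ (b '' {i}) := by
    rw [eigenspace_eq_span_image hb]
    simp only [hν.eq_iff, Set.ofPred_eq_eq_singleton]
  have hlabel (j : Fin 3) (s : Set (Fin 4)) (hs : {i | ![0, 1, 1, 2] i = j} = s) :
      S.labelSpan b j = Submodule.span ℝ (b '' s) :=
    hs ▸ rfl
  refine ⟨S, b, hsurj, hb, ?_, ?_, ?_, S.finrank_labelSpan b 1⟩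
  · exact (hlabel 0 {0} (by ext; decide +revert)).trans (heig 0).symm
  · rw [hlabel 1 ({1} ∪ {2}) (by ext; decide +revert), Set.image_union, Submodule.span_union,
      ← heig, ← heig]
    rfl
  · exact (hlabel 2 {3} (by ext; decide +revert)).trans (heig 3).symm

end

end ToralPH

open ToralPH in
theorem mainTheorem5_general {n : ℕ} {A : Matrix.SpecialLinearGroup (Fin n) ℤ} {ι : Type*}
    (S : SpectralData ι) (hτ : Function.Surjective S.τ) (b : Module.Basis ι ℝ (E n))
    (hb : ∀ i, linMap A (b i) = S.ν i • b i) {ε : ℝ} (hε : 0 < ε) :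
    ∃ (f : Equiv.Perm (Torus n)) (Ess Euu : Torus n → Submodule ℝ (E n)),
      MemPH A (S.labelSpan b 0) (S.labelSpan b 1) (S.labelSpan b 2) f
        Ess (fun _ => S.labelSpan b 1) Euu ∧
      (∀ x, x ∉ proj '' Metric.ball (0 : E n) ε → f x = toralAut A x) ∧
      IsExpansive f ∧ f 0 = 0 ∧ ∀ v ∈ S.labelSpan b 1, torusDeriv f 0 v = v := by
  have := FiniteDimensional.fintypeBasisIndex b
  obtain ⟨𝓣, rfl, hT, hsmall⟩ := S.exists_toralModel (coordinates b) (S.coordinates_linMap hb) hε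
  have hspan (j : Fin 3) : 𝓣.labelSpan b j = 𝓣.linearBundle j := by
    ext v
    rw [SpectralData.mem_labelSpan, 𝓣.mem_linearBundle, hT]
  have hne (j : Fin 3) : 𝓣.linearBundle j ≠ ⊥ := hspan j ▸ 𝓣.labelSpan_ne_bot b j hτ
  simp only [hspan]
  obtain ⟨Ess, Euu, hPH⟩ := 𝓣.exists_memPH hne
  exact ⟨𝓣.perm 1, Ess, Euu, hPH, fun x hx => 𝓣.perm_eq_toralAut_of_notMem 1 hsmall hx,
    𝓣.isExpansive_perm, 𝓣.perm_zero 1, fun v hv => 𝓣.torusDeriv_perm_one_zero hv⟩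

theorem mainTheorem5 :
    (∀ (n k : ℕ) (A : Matrix.SpecialLinearGroup (Fin n) ℤ)
        (Sss Sc Suu : Submodule ℝ (ToralPH.E n)) (lam : Fin k → ℝ)
        (b : Module.Basis (Fin k) ℝ Sc),
        A.1.IsSymm →
        ToralPH.IsPartiallyHyperbolic (ToralPH.toralAut A)
          (fun _ => Sss) (fun _ => Sc) (fun _ => Suu) →
        Monotone lam → (∀ i, 0 < lam i ∧ lam i < 1) →
        (∀ i, ToralPH.linMap A (b i) = lam i • (b i : ToralPH.E n)) →
        ∀ ε : ℝ, 0 < ε →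
          ∃ (f : Equiv.Perm (ToralPH.Torus n))
            (Ess Ec Euu : ToralPH.Torus n → Submodule ℝ (ToralPH.E n)),
            ToralPH.MemPH A Sss Sc Suu f Ess Ec Euu ∧
            (∀ x, x ∉ ToralPH.proj '' Metric.ball (0 : ToralPH.E n) ε →
              f x = ToralPH.toralAut A x) ∧
            ToralPH.IsExpansive f ∧
            f 0 = 0 ∧ ∀ v ∈ Ec 0, ToralPH.torusDeriv f 0 v = v) ∧
    (∀ (A : Matrix.SpecialLinearGroup (Fin 4) ℤ) (lss l m muu : ℝ),
        0 < lss → lss < l → l < 1 → 1 < m → m < muu →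
        Module.End.HasEigenvalue (ToralPH.linMap A) lss →
        Module.End.HasEigenvalue (ToralPH.linMap A) l →
        Module.End.HasEigenvalue (ToralPH.linMap A) m →
        Module.End.HasEigenvalue (ToralPH.linMap A) muu →
        ∀ ε : ℝ, 0 < ε →
          ∃ (f : Equiv.Perm (ToralPH.Torus 4))
            (Ess Ec Euu : ToralPH.Torus 4 → Submodule ℝ (ToralPH.E 4)),
            ToralPH.MemPH A
              (Module.End.eigenspace (ToralPH.linMap A) lss)
              (Module.End.eigenspace (ToralPH.linMap A) l ⊔
                Module.End.eigenspace (ToralPH.linMap A) m)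
              (Module.End.eigenspace (ToralPH.linMap A) muu) f Ess Ec Euu ∧
            (∀ x, Module.finrank ℝ (Ec x) = 2) ∧
            (∀ x, x ∉ ToralPH.proj '' Metric.ball (0 : ToralPH.E 4) ε →
              f x = ToralPH.toralAut A x) ∧
            ToralPH.IsExpansive f ∧
            f 0 = 0 ∧ ∀ v ∈ Ec 0, ToralPH.torusDeriv f 0 v = v) := by
  constructor
  · intro n k A Sss Sc Suu lam b hA hPH _ hlam hb ε hε
    obtain ⟨_, S, c, hτ, hc, rfl, rfl, rfl⟩ := hPH.exists_spectralData_of_isSymm hA b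
      (fun i => ⟨(hlam i).1, (hlam i).2.ne⟩) hb
    obtain ⟨f, Ess, Euu, h⟩ := mainTheorem5_general S hτ c hc hε
    exact ⟨f, Ess, _, Euu, h⟩
  · intro A lss l m muu h0 h1 h2 h3 h4 hss hl hm huu ε hε
    obtain ⟨S, b, hτ, hb, h_ss, h_c, h_uu, hdim⟩ :=
      ToralPH.exists_spectralData_of_hasEigenvalue h0 h1 h2 h3 h4 hss hl hm huu
    rw [← h_ss, ← h_c, ← h_uu]
    obtain ⟨f, Ess, Euu, hPH, h⟩ := mainTheorem5_general S hτ b hb hε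
    exact ⟨f, Ess, _, Euu, hPH, fun _ => hdim, h⟩
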